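/- Let $\psi:\mathbb{N}=\{1,2,3,\dots\}\to\mathbb{R}$ be a non-negative function, let $\varphi$ be the Euler totient function, let $\lambda$ be the Lebesgue measure, and read $\log x$ as $\max(1,\log x)$. For $n\ge 1$ let $\mathcal{E}_n\subset\mathbb{R}/\mathbb{Z}$ be the image modulo one of $$\bigcup_{\substack{1\le a\le n\\ \gcd(a,n)=1}}\left(\frac{a-\psi(n)}{n},\frac{a+\psi(n)}{n}\right),$$ and let $W(\psi)$ be the set of those $x\in[0,1]$ which modulo one are contained in infinitely many of the sets $\mathcal{E}_n$. Suppose that there is a constant $\varepsilon>0$ such that $$\sum_{n=1}^\infty\frac{\psi(n)\varphi(n)}{n(\log n)^{\varepsilon}}=\infty.$$ Then $\lambda(W(\psi))=1$. Moreover, for almost every $x\in\mathbb{R}$ there are infinitely many pairs $(a,n)$ of coprime integers with $n\ge 1$ and $|nx-a|<\psi(n)$. -/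

import Mathlib

/-- The logarithm with the convention that `log x` is read as `max (1, log x)`. -/
noncomputable def logOne (x : ℝ) : ℝ := max 1 (Real.log x)

/-- The set `E_n ⊆ ℝ / ℤ`: the union, over the integers `1 ≤ a ≤ n` coprime to `n`, of the images
modulo one of the open intervals `((a - ψ(n)) / n, (a + ψ(n)) / n)`. It is empty for `n = 0`. -/
def approxSet (ψ : ℕ → ℝ) (n : ℕ) : Set UnitAddCircle :=
  ⋃ a ∈ {a : ℕ | 1 ≤ a ∧ a ≤ n ∧ a.Coprime n},
    (fun y : ℝ => (y : UnitAddCircle)) ''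
      Set.Ioo (((a : ℝ) - ψ n) / (n : ℝ)) (((a : ℝ) + ψ n) / (n : ℝ))

/-- The set `W(ψ)` of those `x ∈ [0, 1]` whose classes modulo one lie in infinitely many of the
sets `E_n`. -/
def limsupSet (ψ : ℕ → ℝ) : Set ℝ :=
  {x : ℝ | x ∈ Set.Icc (0 : ℝ) 1 ∧ {n : ℕ | (x : UnitAddCircle) ∈ approxSet ψ n}.Infinite}

/-- The coprime pairs `(a, n)`, with `a` an integer and `n` a positive integer, which satisfy
`|n x - a| < ψ(n)`. -/
def coprimeSolutions (ψ : ℕ → ℝ) (x : ℝ) : Set (ℤ × ℕ) :=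
  {p : ℤ × ℕ | 0 < p.2 ∧ IsCoprime p.1 (p.2 : ℤ) ∧ |(p.2 : ℝ) * x - (p.1 : ℝ)| < ψ p.2}

/-! Put `δ n = ψ n / n`. If `δ n → 0`, Gallagher's zero-one law makes the limsup set on the circle
null or full. It then suffices to bound below, for infinitely many disjoint finite blocks of `n`,
the measure of the union of the balls of radius `δ n` about the reduced fractions `a / n`.
Truncating `ψ n` at `√n / 2` gives `δ n → 0` without losing divergence (`not_summable_min_sqrt`).

The blocks are the ranges where `log n` is of size `exp j`. The extra divergence forces `S = ∑ φ(n)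
δ n ≥ exp (ε j / 2)` on infinitely many of them (`frequently_block_sum_ge`). This leaves room to
shrink all radii by any `exp (-k)` with `1 ≤ k ≤ K`, `K` about `ε j / 2`, while the total measure of
the balls stays at least 1. By Chung–Erdős it is enough that for one such `k` the overlaps of
distinct balls are bounded by a constant times the square of that total, and this is proved on
average over `k` (`volume_real_iUnion_ball_ge`).

Overlaps reduce to counting pairs of close reduced fractions. For denominators `g m` and `g n` with
`m`, `n` coprime, the differences are `c / (g m n)` with `c` coprime to `m n`, and a sieve over the
primes dividing `g` counts the pairs for each `c` (`card_residuePairs_mul_le`). The sum of `c /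
φ(c)` over these `c` supplies the needed saving `φ(m n) / (m n)` once its range is longer than `log
(m n)` (`sum_div_totient_le`). Shorter ranges may lack the saving one by one, but summed over all
scales they cost only a factor `log T`, with `T` a bound for `log (m n)`
(`sum_scales_div_totient_le`). On block `j` this is `O(j) = O(K / ε)`, so averaging over `K` scales
leaves a constant depending only on `ε`. -/

/-! ### Upper bounds of Chebyshev and Mertens type -/

open Finset ArithmeticFunction in
theorem sum_Ioc_divisorsAntidiagonal {R : Type*} [AddCommMonoid R] (F : ℕ → ℕ → R) (n : ℕ) :
    ∑ c ∈ Ioc 0 n, ∑ x ∈ c.divisorsAntidiagonal, F x.1 x.2 =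
      ∑ e ∈ Ioc 0 n, ∑ d ∈ Ioc 0 (n / e), F d e := by
  rw [sum_sigma', sum_sigma']
  refine sum_bij' (fun x _ => ⟨x.2.2, x.2.1⟩) (fun x _ => ⟨x.2 * x.1, (x.2, x.1)⟩) ?_ ?_ ?_ ?_ ?_
  · rintro ⟨c, d, e⟩ h
    simp only [mem_sigma, mem_Ioc, Nat.mem_divisorsAntidiagonal] at h ⊢
    obtain ⟨⟨h1, h2⟩, rfl, h3⟩ := h
    have hd : 0 < d := Nat.pos_of_ne_zero (by rintro rfl; simp at h3)
    have he : 0 < e := Nat.pos_of_ne_zero (by rintro rfl; simp at h3)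
    refine ⟨⟨he, le_trans (Nat.le_mul_of_pos_left e hd) h2⟩, hd, ?_⟩
    exact (Nat.le_div_iff_mul_le he).2 h2
  · rintro ⟨e, d⟩ h
    simp only [mem_sigma, mem_Ioc, Nat.mem_divisorsAntidiagonal] at h ⊢
    obtain ⟨⟨h1, h2⟩, h3, h4⟩ := h
    exact ⟨⟨Nat.mul_pos h3 h1, (Nat.le_div_iff_mul_le h1).1 h4⟩, trivial, (Nat.mul_pos h3 h1).ne'⟩
  · rintro ⟨c, d, e⟩ h
    simp only [mem_sigma, mem_Ioc, Nat.mem_divisorsAntidiagonal] at h ⊢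
    obtain ⟨⟨h1, h2⟩, rfl, h3⟩ := h
    rfl
  · rintro ⟨e, d⟩ h
    rfl
  · rintro ⟨c, d, e⟩ h
    rfl

open Finset ArithmeticFunction in
theorem log_eq_sum_divisorsAntidiagonal (c : ℕ) :
    Real.log c = ∑ x ∈ c.divisorsAntidiagonal, vonMangoldt x.1 := by
  rw [← vonMangoldt_sum, ← Nat.map_div_right_divisors, sum_map]
  rfl

-- In `log n! = ∑ Λ(d) ⌊n / d⌋` each `d ≤ n` has `⌊n / d⌋ ≥ 1`, hence `n / d ≤ 2 ⌊n / d⌋`, while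
-- `log n! ≤ n log n`.
open Finset ArithmeticFunction in
theorem sum_vonMangoldt_div_le (n : ℕ) :
    ∑ d ∈ Ioc 0 n, vonMangoldt d / d ≤ 2 * Real.log n := by
  rcases Nat.eq_zero_or_pos n with rfl | hn
  · simp
  have hn' : (0 : ℝ) < n := by exact_mod_cast hn
  have h1 : ∑ c ∈ Ioc 0 n, Real.log c = ∑ d ∈ Ioc 0 n, vonMangoldt d * ((n / d : ℕ) : ℝ) := by
    rw [← sum_Ioc_mul_zeta_eq_sum, vonMangoldt_mul_zeta]
    rfl
  have h2 : ∑ c ∈ Ioc 0 n, Real.log c ≤ n * Real.log n := by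
    calc ∑ c ∈ Ioc 0 n, Real.log c ≤ ∑ c ∈ Ioc 0 n, Real.log n := by
          refine sum_le_sum fun c hc => ?_
          rw [mem_Ioc] at hc
          exact Real.log_le_log (by exact_mod_cast hc.1) (by exact_mod_cast hc.2)
      _ = n * Real.log n := by simp
  have h3 : n * ∑ d ∈ Ioc 0 n, vonMangoldt d / d ≤
      2 * ∑ d ∈ Ioc 0 n, vonMangoldt d * ((n / d : ℕ) : ℝ) := by
    rw [mul_sum, mul_sum]
    refine sum_le_sum fun d hd => ?_
    rw [mem_Ioc] at hd
    have hd' : (0 : ℝ) < d := by exact_mod_cast hd.1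
    have h4 : (n : ℝ) / d ≤ 2 * ((n / d : ℕ) : ℝ) := by
      have h5 : 1 ≤ n / d := (Nat.one_le_div_iff hd.1).2 hd.2
      have h6 : (n : ℝ) / d < ((n / d : ℕ) : ℝ) + 1 := by
        rw [div_lt_iff₀ hd']
        exact_mod_cast (Nat.div_lt_iff_lt_mul hd.1).1 (Nat.lt_succ_self _)
      have h7 : (1 : ℝ) ≤ ((n / d : ℕ) : ℝ) := by exact_mod_cast h5
      linarith
    have h8 : 0 ≤ vonMangoldt d := vonMangoldt_nonneg
    calc n * (vonMangoldt d / d) = vonMangoldt d * (n / d) := by ring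
      _ ≤ vonMangoldt d * (2 * ((n / d : ℕ) : ℝ)) := by gcongr
      _ = _ := by ring
  rw [← h1] at h3
  have h9 : n * ∑ d ∈ Ioc 0 n, vonMangoldt d / d ≤ n * (2 * Real.log n) := by linarith
  exact le_of_mul_le_mul_left h9 hn'

open Finset in
theorem tsum_rpow_neg_le {s : ℝ} (hs : 1 < s) :
    Summable (fun n : ℕ => (n : ℝ) ^ (-s)) ∧ ∑' n : ℕ, (n : ℝ) ^ (-s) ≤ 1 + 1 / (s - 1) := by
  have h1 : Summable (fun n : ℕ => (n : ℝ) ^ (-s)) := Real.summable_nat_rpow.2 (by linarith)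
  refine ⟨h1, ?_⟩
  have h2 := ZetaAsymptotics.zeta_limit_aux1 hs
  have h3 : 0 ≤ ZetaAsymptotics.termTSum s :=
    tsum_nonneg fun n => ZetaAsymptotics.term_nonneg _ _
  rw [h1.tsum_eq_zero_add]
  have h4 : ∀ n : ℕ, ((n + 1 : ℕ) : ℝ) ^ (-s) = 1 / (n + 1 : ℝ) ^ s := by
    intro n
    rw [Real.rpow_neg (by positivity), one_div, Nat.cast_succ]
  simp_rw [h4]
  -- The split-off term at index 0 is `0 ^ (-s) = 0`.
  rw [Nat.cast_zero, Real.zero_rpow (by linarith)]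
  nlinarith

/-- The completely multiplicative function `n ↦ n ^ (-s)`. -/
noncomputable def rpowNegHom (s : ℝ) : ℕ →* ℝ where
  toFun n := (n : ℝ) ^ (-s)
  map_one' := by simp
  map_mul' a b := by rw [Nat.cast_mul, Real.mul_rpow (by positivity) (by positivity)]

open Finset ArithmeticFunction in
theorem prod_primesBelow_rpow_le {s : ℝ} (hs : 1 < s) (n : ℕ) :
    ∏ p ∈ n.primesBelow, (1 - (p : ℝ) ^ (-s))⁻¹ ≤ 1 + 1 / (s - 1) := by
  have h1 := (tsum_rpow_neg_le hs).1
  have h := EulerProduct.summable_and_hasSum_smoothNumbers_prod_primesBelow_geometric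
    (f := rpowNegHom s) (fun {p} hp => by
      have : (1 : ℝ) < p := by exact_mod_cast hp.one_lt
      have h0 : 0 ≤ rpowNegHom s p := Real.rpow_nonneg (Nat.cast_nonneg p) (-s)
      rw [Real.norm_of_nonneg h0]
      exact Real.rpow_lt_one_of_one_lt_of_neg this (by linarith)) n
  refine le_trans ?_ (tsum_rpow_neg_le hs).2
  have h2 := h.2.tsum_eq
  simp only [rpowNegHom, MonoidHom.coe_mk, OneHom.coe_mk] at h2
  rw [← h2]
  exact Summable.tsum_subtype_le _ _ (fun n => Real.rpow_nonneg (Nat.cast_nonneg n) _) h1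

-- Rankin's trick: moving the exponent from 1 to `s = 1 + 1 / log n` costs a factor `exp (2 log p /
-- (p log n))` at each prime, hence at most `exp 4` in total by `sum_vonMangoldt_div_le`. The
-- product at `s` is at most `1 + log n ≤ 3 log n`.
open Finset ArithmeticFunction in
theorem prod_primesBelow_inv_le {n : ℕ} (hn : 2 ≤ n) :
    ∏ p ∈ (n + 1).primesBelow, (1 - (p : ℝ)⁻¹)⁻¹ ≤ 3 * Real.exp 4 * Real.log n := by
  have hn2 : (2 : ℝ) ≤ n := by exact_mod_cast hn
  have hL : 0.69 < Real.log n :=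
    lt_of_lt_of_le (by linarith [Real.log_two_gt_d9]) (Real.log_le_log (by norm_num) hn2)
  have hL0 : 0 < Real.log n := by linarith
  set L := Real.log n with hLdef
  set s : ℝ := 1 + 1 / L with hs
  have hs1 : 1 < s := by rw [hs]; linarith [one_div_pos.2 hL0]
  have key : ∀ p ∈ (n + 1).primesBelow, (1 - (p : ℝ)⁻¹)⁻¹ ≤
      (1 - (p : ℝ) ^ (-s))⁻¹ * Real.exp (2 / L * (vonMangoldt p / p)) := by
    intro p hp
    have hpp := Nat.prime_of_mem_primesBelow hp
    have hp2 : (2 : ℝ) ≤ p := by exact_mod_cast hpp.two_le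
    have hp0 : (0 : ℝ) < p := by linarith
    have ha : (p : ℝ)⁻¹ ≤ 1 / 2 := by
      rw [inv_eq_one_div]; exact one_div_le_one_div_of_le (by norm_num) hp2
    have ha0 : (0 : ℝ) < (p : ℝ)⁻¹ := by positivity
    have hb : (p : ℝ) ^ (-s) = (p : ℝ)⁻¹ * Real.exp (-(Real.log p / L)) := by
      rw [Real.rpow_def_of_pos hp0, ← Real.exp_log ha0, Real.log_inv, ← Real.exp_add, hs]
      congr 1; ring
    have hlogp : 0 ≤ Real.log p := Real.log_nonneg (by linarith)
    have hc : 1 - Real.log p / L ≤ Real.exp (-(Real.log p / L)) := by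
      have := Real.add_one_le_exp (-(Real.log p / L)); linarith
    have hd : Real.exp (-(Real.log p / L)) ≤ 1 := by
      rw [Real.exp_le_one_iff]; have := div_nonneg hlogp hL0.le; linarith
    have he : 0 < 1 - (p : ℝ) ^ (-s) := by rw [hb]; nlinarith
    rw [vonMangoldt_apply_prime hpp]
    rw [inv_mul_eq_div, le_div_iff₀ he, inv_mul_le_iff₀ (by linarith)]
    have hf := Real.add_one_le_exp (2 / L * (Real.log p / p))
    have hg : 1 - (p : ℝ) ^ (-s) ≤ (1 - (p : ℝ)⁻¹) * (2 / L * (Real.log p / p) + 1) := by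
      rw [hb]
      have h1 : 2 / L * (Real.log p / p) = 2 * (p : ℝ)⁻¹ * (Real.log p / L) := by
        field_simp
      rw [h1]
      have h2 : 0 ≤ Real.log p / L := div_nonneg hlogp hL0.le
      have h3 : 0 ≤ (p : ℝ)⁻¹ * (Real.log p / L) := by positivity
      nlinarith
    exact hg.trans (mul_le_mul_of_nonneg_left hf (by linarith))
  have hpos : ∀ p ∈ (n + 1).primesBelow, 0 ≤ (1 - (p : ℝ)⁻¹)⁻¹ := by
    intro p hp
    have hp2 : (1 : ℝ) ≤ p := by exact_mod_cast (Nat.prime_of_mem_primesBelow hp).one_le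
    exact inv_nonneg.2 (sub_nonneg.2 (inv_le_one_of_one_le₀ hp2))
  refine (prod_le_prod hpos key).trans ?_
  rw [prod_mul_distrib, ← Real.exp_sum, ← mul_sum]
  have hA := prod_primesBelow_rpow_le hs1 (n + 1)
  have hB : ∑ p ∈ (n + 1).primesBelow, vonMangoldt p / p ≤ 2 * L := by
    refine le_trans ?_ (sum_vonMangoldt_div_le n)
    refine sum_le_sum_of_subset_of_nonneg ?_ fun d _ _ =>
      div_nonneg vonMangoldt_nonneg (by positivity)
    intro p hp
    rw [mem_Ioc]
    exact ⟨(Nat.prime_of_mem_primesBelow hp).pos,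
      Nat.lt_succ_iff.1 (Nat.lt_of_mem_primesBelow hp)⟩
  have hC : 2 / L * ∑ p ∈ (n + 1).primesBelow, vonMangoldt p / p ≤ 4 := by
    calc _ ≤ 2 / L * (2 * L) := by gcongr
      _ = 4 := by field_simp; norm_num
  have hD : 1 + 1 / (s - 1) ≤ 3 * L := by
    rw [hs]; simp only [add_sub_cancel_left, one_div_one_div]; linarith
  calc _ ≤ (3 * L) * Real.exp 4 := by
        gcongr
        exact hA.trans hD
    _ = _ := by ring

/-! ### Sums of `1 / φ(c)` and `c / φ(c)` over integers coprime to `N` -/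

/-- The ratio `φ(n) / n`. -/
noncomputable def totientRatio (n : ℕ) : ℝ := (n.totient : ℝ) / n

theorem totientRatio_eq_prod {n : ℕ} (hn : n ≠ 0) :
    totientRatio n = ∏ p ∈ n.primeFactors, (1 - (p : ℝ)⁻¹) := by
  have h := Nat.totient_eq_mul_prod_factors n
  have h' : (n.totient : ℝ) = n * ∏ p ∈ n.primeFactors, (1 - (p : ℝ)⁻¹) := by
    have h2 := congrArg (fun q : ℚ => (q : ℝ)) h
    push_cast at h2
    exact h2
  have : (n : ℝ) ≠ 0 := by exact_mod_cast hn
  rw [totientRatio, h']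
  field_simp

theorem one_sub_inv_pos {p : ℕ} (hp : p.Prime) : (0 : ℝ) < 1 - (p : ℝ)⁻¹ := by
  have : (1 : ℝ) < p := by exact_mod_cast hp.one_lt
  exact sub_pos.2 (inv_lt_one_of_one_lt₀ this)

theorem totientRatio_pos {n : ℕ} (hn : n ≠ 0) : 0 < totientRatio n := by
  rw [totientRatio]
  have := Nat.totient_pos.2 (Nat.pos_of_ne_zero hn)
  have := Nat.pos_of_ne_zero hn
  positivity

open Finset in
theorem hasSum_inv_totient_prime_pow {p : ℕ} (hp : p.Prime) :
    HasSum (fun e : ℕ => (((p ^ e).totient : ℝ))⁻¹) (1 + p / ((p : ℝ) - 1) ^ 2) := by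
  have hp1 : (1 : ℝ) < p := by exact_mod_cast hp.one_lt
  rw [← hasSum_nat_add_iff' 1]
  have h := (hasSum_geometric_of_lt_one (r := (p : ℝ)⁻¹) (by positivity)
    (inv_lt_one_of_one_lt₀ hp1)).mul_left ((p : ℝ) - 1)⁻¹
  have h1 : (fun e : ℕ => (((p ^ (e + 1)).totient : ℝ))⁻¹) =
      fun e : ℕ => ((p : ℝ) - 1)⁻¹ * ((p : ℝ)⁻¹) ^ e := by
    funext e
    rw [Nat.totient_prime_pow_succ hp, Nat.cast_mul, Nat.cast_pow, Nat.cast_pred hp.pos, mul_inv,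
      inv_pow, mul_comm]
  have h2 : 1 + (p : ℝ) / ((p : ℝ) - 1) ^ 2 - ∑ i ∈ range 1, (((p ^ i).totient : ℝ))⁻¹ =
      ((p : ℝ) - 1)⁻¹ * (1 - (p : ℝ)⁻¹)⁻¹ := by
    have h3 : (p : ℝ) - 1 ≠ 0 := by linarith
    have h4 : 1 - (p : ℝ)⁻¹ = ((p : ℝ) - 1) / p := by field_simp
    rw [h4]
    simp
    field_simp
  rw [h1, h2]
  exact h

-- After passing to exponentials, the sum of `1 / (p (p - 1))` telescopes over all integers in `(1,
-- n]`, so primality plays no role.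
open Finset in
theorem prod_one_add_inv_mul_pred_le (n : ℕ) (S : Finset ℕ) (hS : S ⊆ Ioc 1 n) :
    ∏ p ∈ S, (1 + 1 / ((p : ℝ) * (p - 1))) ≤ Real.exp 1 := by
  have hk : ∀ p ∈ Ioc 1 n, (0 : ℝ) ≤ 1 / ((p : ℝ) * (p - 1)) := by
    intro p hp
    rw [mem_Ioc] at hp
    have : (1 : ℝ) < p := by exact_mod_cast hp.1
    have : (0 : ℝ) < p - 1 := by linarith
    positivity
  have h1 : ∏ p ∈ S, (1 + 1 / ((p : ℝ) * (p - 1))) ≤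
      Real.exp (∑ p ∈ S, 1 / ((p : ℝ) * (p - 1))) := by
    rw [Real.exp_sum]
    refine prod_le_prod (fun p hp => by have := hk p (hS hp); linarith) fun p hp => ?_
    have := Real.add_one_le_exp (1 / ((p : ℝ) * (p - 1)))
    linarith
  refine h1.trans (Real.exp_le_exp.2 ?_)
  refine (sum_le_sum_of_subset_of_nonneg hS fun p hp _ => hk p hp).trans ?_
  have h2 : ∀ n : ℕ, 1 ≤ n → ∑ p ∈ Ioc 1 n, 1 / ((p : ℝ) * (p - 1)) = 1 - 1 / n := by
    intro n hn
    induction n, hn using Nat.le_induction with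
    | base => simp
    | succ k hk ih =>
      rw [sum_Ioc_succ_top hk, ih]
      have : (0 : ℝ) < k := by exact_mod_cast hk
      rw [show ((k + 1 : ℕ) : ℝ) - 1 = k by push_cast; ring]
      push_cast
      field_simp
      ring
  rcases Nat.eq_zero_or_pos n with rfl | hn
  · simp
  · rw [h2 n hn]
    have : (0 : ℝ) ≤ 1 / n := by positivity
    linarith

open Finset in
theorem hasSum_inv_totient_factoredNumbers (s : Finset ℕ) :
    HasSum (fun c : Nat.factoredNumbers s => (((c : ℕ).totient : ℝ))⁻¹)
      (∏ p ∈ s with p.Prime, (1 + p / ((p : ℝ) - 1) ^ 2)) := by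
  have hmul : ∀ {a b : ℕ}, a.Coprime b →
      (((a * b).totient : ℝ))⁻¹ = ((a.totient : ℝ))⁻¹ * ((b.totient : ℝ))⁻¹ := by
    intro a b hab
    rw [Nat.totient_mul hab, Nat.cast_mul, mul_inv]
  have hsum : ∀ {p : ℕ}, p.Prime → Summable fun e : ℕ => ‖(((p ^ e).totient : ℝ))⁻¹‖ :=
    fun {p} hp => (hasSum_inv_totient_prime_pow hp).summable.norm
  have h1 : (((1 : ℕ).totient : ℝ))⁻¹ = 1 := by simp
  have h := (EulerProduct.summable_and_hasSum_factoredNumbers_prod_filter_prime_tsum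
    (f := fun c : ℕ => ((c.totient : ℝ))⁻¹) h1 hmul hsum s).2
  have h2 : ∏ p ∈ s with p.Prime, ∑' e : ℕ, (((p ^ e).totient : ℝ))⁻¹ =
      ∏ p ∈ s with p.Prime, (1 + p / ((p : ℝ) - 1) ^ 2) :=
    prod_congr rfl fun p hp => (hasSum_inv_totient_prime_pow (mem_filter.1 hp).2).tsum_eq
  exact h2 ▸ h

-- The integers counted have all prime factors at most `n` and prime to `N`, so an Euler product
-- dominates. Its factor `1 + p / (p - 1) ^ 2` is `(1 - 1 / p)⁻¹` times `1 + 1 / (p (p - 1))`, and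
-- the latter multiply to at most `e`.
open Finset in
theorem sum_inv_totient_le_prod (N n : ℕ) :
    ∑ c ∈ Ioc 0 n with c.Coprime N, ((c.totient : ℝ))⁻¹ ≤
      Real.exp 1 * ∏ p ∈ (n + 1).primesBelow with ¬ p ∣ N, (1 - (p : ℝ)⁻¹)⁻¹ := by
  have h := hasSum_inv_totient_factoredNumbers ((range (n + 1)).filter (fun p => ¬ p ∣ N))
  have hsf : ((range (n + 1)).filter (fun p => ¬ p ∣ N)).filter Nat.Prime =
      (n + 1).primesBelow.filter (fun p => ¬ p ∣ N) := by
    ext p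
    simp only [mem_filter, mem_range, Nat.mem_primesBelow]
    tauto
  rw [hsf] at h
  have h2 := (hasSum_subtype_iff_indicator (f := fun c : ℕ => ((c.totient : ℝ))⁻¹)).1 h
  have hind : ∀ c ∈ (Ioc 0 n).filter (fun c => c.Coprime N),
      (Nat.factoredNumbers ((range (n + 1)).filter (fun p => ¬ p ∣ N))).indicator
        (fun c : ℕ => ((c.totient : ℝ))⁻¹) c = ((c.totient : ℝ))⁻¹ := by
    intro c hc
    refine Set.indicator_of_mem ?_ _
    rw [mem_filter, mem_Ioc] at hc
    rw [Nat.mem_factoredNumbers']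
    intro p hp hpc
    rw [mem_filter, mem_range]
    refine ⟨Nat.lt_succ_iff.2 ((Nat.le_of_dvd hc.1.1 hpc).trans hc.1.2), fun hpN => ?_⟩
    exact hp.one_lt.ne' (Nat.eq_one_of_dvd_coprimes hc.2 hpc hpN)
  have h3 : ∑ c ∈ Ioc 0 n with c.Coprime N, ((c.totient : ℝ))⁻¹ ≤
      ∏ p ∈ (n + 1).primesBelow with ¬ p ∣ N, (1 + p / ((p : ℝ) - 1) ^ 2) := by
    rw [← sum_congr rfl hind]
    exact sum_le_hasSum _ (fun c _ => Set.indicator_nonneg (fun c _ => by positivity) c) h2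
  refine h3.trans ?_
  have h4 : ∀ p ∈ (n + 1).primesBelow.filter (fun p => ¬ p ∣ N),
      1 + p / ((p : ℝ) - 1) ^ 2 = (1 + 1 / ((p : ℝ) * (p - 1))) * (1 - (p : ℝ)⁻¹)⁻¹ := by
    intro p hp
    have hpp := Nat.prime_of_mem_primesBelow (mem_filter.1 hp).1
    have hp1 : (1 : ℝ) < p := by exact_mod_cast hpp.one_lt
    have h5 : (p : ℝ) - 1 ≠ 0 := by linarith
    have h6 : (1 : ℝ) - (p : ℝ)⁻¹ = (p - 1) / p := by field_simp
    rw [h6]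
    field_simp
    ring
  rw [prod_congr rfl h4, prod_mul_distrib]
  refine mul_le_mul_of_nonneg_right ?_ (prod_nonneg fun p hp => ?_)
  · refine prod_one_add_inv_mul_pred_le n _ fun p hp => ?_
    have hp' := (mem_filter.1 hp).1
    rw [mem_Ioc]
    exact ⟨(Nat.prime_of_mem_primesBelow hp').one_lt,
      Nat.lt_succ_iff.1 (Nat.lt_of_mem_primesBelow hp')⟩
  · exact inv_nonneg.2 (one_sub_inv_pos (Nat.prime_of_mem_primesBelow (mem_filter.1 hp).1)).le

-- `N` has at most `log N / log 2 ≤ 2 n` prime factors, and each one beyond `n` contributes at most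
-- `1 + 1 / n ≤ exp (1 / n)`.
open Finset in
theorem prod_large_primeFactors_inv_le {N n : ℕ} (hN : N ≠ 0) (hn : 1 ≤ n)
    (h : Real.log N ≤ n) :
    ∏ p ∈ N.primeFactors with n < p, (1 - (p : ℝ)⁻¹)⁻¹ ≤ Real.exp 2 := by
  have hn0 : (0 : ℝ) < n := by exact_mod_cast hn
  have hcard : ((#N.primeFactors : ℕ) : ℝ) ≤ 2 * n := by
    have h1 : 2 ^ #N.primeFactors ≤ N := by
      calc 2 ^ #N.primeFactors = ∏ p ∈ N.primeFactors, 2 := by simp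
        _ ≤ ∏ p ∈ N.primeFactors, p :=
            prod_le_prod' fun p hp => (Nat.prime_of_mem_primeFactors hp).two_le
        _ ≤ N := Nat.le_of_dvd (Nat.pos_of_ne_zero hN) (Nat.prod_primeFactors_dvd N)
    have h2 : (#N.primeFactors : ℝ) * Real.log 2 ≤ Real.log N := by
      rw [← Real.log_pow]
      exact Real.log_le_log (by positivity) (by exact_mod_cast h1)
    have h3 := Real.log_two_gt_d9
    have h4 : (0 : ℝ) ≤ (#N.primeFactors : ℝ) := by positivity
    nlinarith
  calc ∏ p ∈ N.primeFactors with n < p, (1 - (p : ℝ)⁻¹)⁻¹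
      ≤ ∏ p ∈ N.primeFactors with n < p, Real.exp (1 / n) := by
        refine prod_le_prod (fun p hp => ?_) fun p hp => ?_
        · exact inv_nonneg.2
            (one_sub_inv_pos (Nat.prime_of_mem_primeFactors (mem_filter.1 hp).1)).le
        · have hp1 : (n : ℝ) + 1 ≤ p := by exact_mod_cast (mem_filter.1 hp).2
          have h1 := Real.add_one_le_exp (1 / (n : ℝ))
          refine le_trans ?_ h1
          rw [inv_le_comm₀ (by
            rw [sub_pos]; exact inv_lt_one_of_one_lt₀ (by linarith)) (by positivity)]
          have h2 : (p : ℝ)⁻¹ ≤ ((n : ℝ) + 1)⁻¹ := by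
            exact inv_anti₀ (by positivity) hp1
          have h3 : (1 / (n : ℝ) + 1)⁻¹ = 1 - ((n : ℝ) + 1)⁻¹ := by field_simp; ring
          rw [h3]; linarith
    _ = Real.exp (1 / n) ^ #(N.primeFactors.filter (fun p => n < p)) := by rw [prod_const]
    _ ≤ Real.exp (1 / n) ^ #N.primeFactors := by
        refine pow_le_pow_right₀ (Real.one_le_exp (by positivity)) (card_filter_le _ _)
    _ = Real.exp (#N.primeFactors * (1 / n)) := by rw [← Real.exp_nat_mul]
    _ ≤ Real.exp 2 := by
        rw [Real.exp_le_exp, mul_one_div, div_le_iff₀ hn0]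
        exact hcard

-- Removing the primes dividing `N` from the Mertens product up to `n` leaves `log n` times the part
-- of `φ(N) / N` from primes `p ≤ n`. The hypothesis `log N ≤ n` lets the larger primes be restored
-- at the cost of `exp 2`.
open Finset in
theorem sum_inv_totient_le {N n : ℕ} (hN : N ≠ 0) (hn : 2 ≤ n) (h : Real.log N ≤ n) :
    ∑ c ∈ Ioc 0 n with c.Coprime N, ((c.totient : ℝ))⁻¹ ≤
      3 * Real.exp 7 * Real.log n * totientRatio N := by
  have hpp : ∀ p ∈ (n + 1).primesBelow, (0 : ℝ) < 1 - (p : ℝ)⁻¹ := fun p hp =>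
    one_sub_inv_pos (Nat.prime_of_mem_primesBelow hp)
  have h1 := sum_inv_totient_le_prod N n
  have h2 := prod_primesBelow_inv_le hn
  have h3 := prod_large_primeFactors_inv_le hN (by omega) h
  set A := ∏ p ∈ (n + 1).primesBelow with ¬ p ∣ N, (1 - (p : ℝ)⁻¹)⁻¹ with hA
  set B := ∏ p ∈ (n + 1).primesBelow with p ∣ N, (1 - (p : ℝ)⁻¹) with hB
  set D := ∏ p ∈ N.primeFactors with n < p, (1 - (p : ℝ)⁻¹) with hD
  have hBpos : 0 < B := prod_pos fun p hp => hpp p (mem_filter.1 hp).1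
  have hDpos : 0 < D := prod_pos fun p hp =>
    one_sub_inv_pos (Nat.prime_of_mem_primeFactors (mem_filter.1 hp).1)
  have h4 : ∏ p ∈ (n + 1).primesBelow, (1 - (p : ℝ)⁻¹)⁻¹ = B⁻¹ * A := by
    rw [hB, ← prod_inv_distrib, hA, prod_filter_mul_prod_filter_not]
  have h5 : totientRatio N = B * D := by
    rw [totientRatio_eq_prod hN, ← prod_filter_mul_prod_filter_not _ (fun p => ¬ n < p)]
    simp only [not_not]
    congr 1
    refine prod_congr ?_ fun _ _ => rfl
    ext p
    simp only [mem_filter, Nat.mem_primeFactors, Nat.mem_primesBelow]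
    constructor
    · rintro ⟨⟨a, b, c⟩, d⟩
      exact ⟨⟨by omega, a⟩, b⟩
    · rintro ⟨⟨a, b⟩, c⟩
      exact ⟨⟨b, c, hN⟩, by omega⟩
  rw [prod_inv_distrib] at h3
  rw [h4, inv_mul_le_iff₀ hBpos] at h2
  have h6 : 1 ≤ Real.exp 2 * D := by
    have := mul_le_mul_of_nonneg_right h3 hDpos.le
    rwa [inv_mul_cancel₀ hDpos.ne'] at this
  have hL : 0 ≤ Real.log n := Real.log_natCast_nonneg n
  calc _ ≤ Real.exp 1 * A := h1
    _ ≤ Real.exp 1 * (B * (3 * Real.exp 4 * Real.log n)) := by gcongr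
    _ ≤ Real.exp 1 * (B * (3 * Real.exp 4 * Real.log n)) * (Real.exp 2 * D) :=
        le_mul_of_one_le_right (by positivity) h6
    _ = 3 * (Real.exp 1 * Real.exp 4 * Real.exp 2) * Real.log n * (B * D) := by ring
    _ = _ := by rw [h5, ← Real.exp_add, ← Real.exp_add]; norm_num

-- A prime power has `φ(d) ≥ d / 2`, and `φ(d e) ≥ φ(d) φ(e)` holds without coprimality.
open Finset ArithmeticFunction in
theorem div_totient_mul_le {d e : ℕ} (hd : IsPrimePow d) (he : e ≠ 0) :
    ((d * e : ℕ) : ℝ) / (d * e).totient ≤ 2 * ((e : ℝ) / e.totient) := by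
  obtain ⟨p, k, hp, hk, rfl⟩ := hd
  have hp' := hp.nat_prime
  obtain ⟨k, rfl⟩ : ∃ j, k = j + 1 := ⟨k - 1, by omega⟩
  have h1 : p ^ (k + 1) ≤ 2 * (p ^ (k + 1)).totient := by
    rw [Nat.totient_prime_pow_succ hp', pow_succ, mul_left_comm]
    refine Nat.mul_le_mul_left _ ?_
    have := hp'.two_le
    omega
  have h2 := Nat.totient_super_multiplicative (p ^ (k + 1)) e
  have h3 : 0 < e.totient := Nat.totient_pos.2 (Nat.pos_of_ne_zero he)
  have h4 : 0 < (p ^ (k + 1)).totient := Nat.totient_pos.2 (pow_pos hp'.pos _)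
  have h5 : 0 < (p ^ (k + 1) * e).totient := lt_of_lt_of_le (Nat.mul_pos h4 h3) h2
  rw [← mul_div_assoc, div_le_div_iff₀ (by exact_mod_cast h5) (by exact_mod_cast h3)]
  have h6 : p ^ (k + 1) * e * e.totient ≤ 2 * e * (p ^ (k + 1) * e).totient := by
    calc p ^ (k + 1) * e * e.totient ≤ 2 * (p ^ (k + 1)).totient * e * e.totient := by gcongr
      _ = 2 * e * ((p ^ (k + 1)).totient * e.totient) := by ring
      _ ≤ _ := by gcongr
  exact_mod_cast h6

-- Split `log n = log c + log (n / c)`. The second part is at most `n / c`. The first is expanded as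
-- `∑ Λ(d)` over `d ∣ c`: pulling a prime power out of `c` changes `c / φ(c)` by at most a factor 2,
-- and Chebyshev's bound `5.5 x` for the sum of `Λ` gives `11`, hence `12` in all.
open Finset ArithmeticFunction in
theorem log_mul_sum_div_totient_le (N n : ℕ) :
    Real.log n * ∑ c ∈ Ioc 0 n with c.Coprime N, (c : ℝ) / c.totient ≤
      12 * n * ∑ c ∈ Ioc 0 n with c.Coprime N, ((c.totient : ℝ))⁻¹ := by
  set g : ℕ → ℝ := fun c => if c.Coprime N then (c : ℝ) / c.totient else 0 with hg
  have hg0 : ∀ c, 0 ≤ g c := fun c => by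
    simp only [hg]; split_ifs <;> positivity
  have hgc : ∀ c ∈ Ioc 0 n, g c / c = if c.Coprime N then ((c.totient : ℝ))⁻¹ else 0 := by
    intro c hc
    have : (c : ℝ) ≠ 0 := by exact_mod_cast (mem_Ioc.1 hc).1.ne'
    simp only [hg]
    split_ifs
    · field_simp
    · simp
  rw [sum_filter, sum_filter, ← sum_congr rfl hgc]
  change Real.log n * ∑ c ∈ Ioc 0 n, g c ≤ _
  have h1 : ∑ c ∈ Ioc 0 n, g c * Real.log c ≤ 11 * n * ∑ c ∈ Ioc 0 n, g c / c := by
    calc ∑ c ∈ Ioc 0 n, g c * Real.log c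
        = ∑ c ∈ Ioc 0 n, ∑ x ∈ c.divisorsAntidiagonal, g (x.1 * x.2) * vonMangoldt x.1 := by
          refine sum_congr rfl fun c _ => ?_
          rw [log_eq_sum_divisorsAntidiagonal, mul_sum]
          refine sum_congr rfl fun x hx => ?_
          rw [(Nat.mem_divisorsAntidiagonal.1 hx).1]
      _ = ∑ e ∈ Ioc 0 n, ∑ d ∈ Ioc 0 (n / e), g (d * e) * vonMangoldt d :=
          sum_Ioc_divisorsAntidiagonal (fun d e => g (d * e) * vonMangoldt d) n
      _ ≤ ∑ e ∈ Ioc 0 n, ∑ d ∈ Ioc 0 (n / e), 2 * g e * vonMangoldt d := by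
          refine sum_le_sum fun e he => sum_le_sum fun d _ => ?_
          by_cases hd : IsPrimePow d
          · refine mul_le_mul_of_nonneg_right ?_ vonMangoldt_nonneg
            by_cases hc : (d * e).Coprime N
            · have hc' : e.Coprime N := Nat.Coprime.coprime_mul_left hc
              have h3 : g (d * e) = ((d * e : ℕ) : ℝ) / (d * e).totient := if_pos hc
              have h4 : g e = (e : ℝ) / e.totient := if_pos hc'
              rw [h3, h4]
              exact div_totient_mul_le hd (mem_Ioc.1 he).1.ne'
            · have : g (d * e) = 0 := by simp [hg, hc]
              rw [this]
              have := hg0 e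
              positivity
          · rw [vonMangoldt_eq_zero_iff.2 hd]; simp
      _ = ∑ e ∈ Ioc 0 n, 2 * g e * Chebyshev.psi ((n : ℝ) / e) := by
          refine sum_congr rfl fun e _ => ?_
          rw [← mul_sum, Chebyshev.psi, Nat.floor_div_eq_div]
      _ ≤ ∑ e ∈ Ioc 0 n, 2 * g e * (5.5 * ((n : ℝ) / e)) := by
          refine sum_le_sum fun e _ => ?_
          have h2 := hg0 e
          have h3 : Real.log 4 ≤ 1.5 := by
            rw [show (4 : ℝ) = 2 ^ 2 by norm_num, Real.log_pow]
            have := Real.log_two_lt_d9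
            push_cast
            linarith
          have h4 := Chebyshev.psi_le_const_mul_self (x := (n : ℝ) / e) (by positivity)
          have h5 : (Real.log 4 + 4) * ((n : ℝ) / e) ≤ 5.5 * ((n : ℝ) / e) := by
            gcongr; linarith
          exact mul_le_mul_of_nonneg_left (h4.trans h5) (by positivity)
      _ = 11 * n * ∑ c ∈ Ioc 0 n, g c / c := by
          rw [mul_sum]
          exact sum_congr rfl fun e _ => by ring
  have h2 : ∑ c ∈ Ioc 0 n, g c * (Real.log n - Real.log c) ≤ n * ∑ c ∈ Ioc 0 n, g c / c := by
    rw [mul_sum]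
    refine sum_le_sum fun c hc => ?_
    rw [mem_Ioc] at hc
    have hc0 : (0 : ℝ) < c := by exact_mod_cast hc.1
    have hn0 : (0 : ℝ) < n := by exact_mod_cast hc.1.trans_le hc.2
    rw [← Real.log_div hn0.ne' hc0.ne']
    have h3 := Real.log_le_sub_one_of_pos (div_pos hn0 hc0)
    calc g c * Real.log (n / c) ≤ g c * (n / c) :=
          mul_le_mul_of_nonneg_left (by linarith) (hg0 c)
      _ = n * (g c / c) := by ring
  have h3 : Real.log n * ∑ c ∈ Ioc 0 n, g c =
      ∑ c ∈ Ioc 0 n, g c * Real.log c + ∑ c ∈ Ioc 0 n, g c * (Real.log n - Real.log c) := by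
    rw [← sum_add_distrib, mul_sum]
    exact sum_congr rfl fun c _ => by ring
  rw [h3]
  linarith

open Finset in
theorem sum_div_totient_le {N n : ℕ} (hN : N ≠ 0) (hn : 2 ≤ n) (h : Real.log N ≤ n) :
    ∑ c ∈ Ioc 0 n with c.Coprime N, (c : ℝ) / c.totient ≤
      36 * Real.exp 7 * n * totientRatio N := by
  have hL : 0 < Real.log n := Real.log_pos (by exact_mod_cast hn)
  have h1 := log_mul_sum_div_totient_le N n
  have h2 := mul_le_mul_of_nonneg_left (sum_inv_totient_le hN hn h)
    (by positivity : (0 : ℝ) ≤ 12 * n)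
  refine le_of_mul_le_mul_left (a := Real.log n) ?_ hL
  calc _ ≤ _ := h1.trans h2
    _ = _ := by ring

/-! ### Averaging over geometric scales -/

open Finset in
theorem sum_exp_le (K : ℕ) : ∑ k ∈ Icc 1 K, Real.exp k ≤ 2 * Real.exp K := by
  induction K with
  | zero => simp
  | succ K ih =>
    rw [sum_Icc_succ_top (by omega)]
    have h : 2 * Real.exp K ≤ Real.exp ((K + 1 : ℕ) : ℝ) := by
      push_cast
      rw [Real.exp_add, mul_comm]
      have := Real.exp_one_gt_d9
      gcongr
      linarith
    linarith

open Finset in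
theorem sum_exp_filter_le (K : ℕ) {y : ℝ} (hy : 0 ≤ y) :
    ∑ k ∈ Icc 1 K with Real.exp (k : ℕ) ≤ y, Real.exp k ≤ 2 * y := by
  induction K with
  | zero => simpa using hy
  | succ K ih =>
    by_cases h : Real.exp ((K + 1 : ℕ) : ℝ) ≤ y
    · refine le_trans (sum_le_sum_of_subset_of_nonneg (filter_subset _ _)
        fun _ _ _ => (Real.exp_pos _).le) ((sum_exp_le (K + 1)).trans (by linarith))
    · rw [sum_filter, sum_Icc_succ_top (by omega), if_neg h, add_zero, ← sum_filter]
      exact ih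

open Finset in
/-- The sum of `c / φ(c)` over those `c ≤ exp (-k) * X` which are coprime to `N`, weighted by
`exp k` and summed over the scales `1 ≤ k ≤ K`. -/
theorem sum_scales_div_totient_le {N T : ℕ} (hN : N ≠ 0) (hT : 2 ≤ T) (h : Real.log N ≤ T)
    {X : ℝ} (hX : 0 ≤ X) (K : ℕ) :
    ∑ k ∈ Icc 1 K, Real.exp k *
        ∑ c ∈ Ioc 0 ⌊Real.exp (-k) * X⌋₊ with c.Coprime N, (c : ℝ) / c.totient ≤
      36 * Real.exp 7 * (K + Real.log T) * X * totientRatio N := by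
  have hrho := (totientRatio_pos hN).le
  have hL : 0 ≤ Real.log T := Real.log_natCast_nonneg T
  set g : ℕ → ℝ := fun c => (c : ℝ) / c.totient with hg
  have hg0 : ∀ c, 0 ≤ g c := fun c => by positivity
  have hterm : ∀ k ∈ Icc 1 K, Real.exp k *
      ∑ c ∈ Ioc 0 ⌊Real.exp (-k) * X⌋₊ with c.Coprime N, g c ≤
        36 * Real.exp 7 * X * totientRatio N +
          ∑ c ∈ Ioc 0 T with c.Coprime N, g c * if Real.exp k ≤ X / c then Real.exp k else 0 := by
    intro k _
    have hnn : 0 ≤ ∑ c ∈ Ioc 0 T with c.Coprime N,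
        g c * if Real.exp k ≤ X / c then Real.exp k else 0 := by
      refine sum_nonneg fun c _ => mul_nonneg (hg0 c) ?_
      split_ifs <;> positivity
    have hXk : Real.exp k * (Real.exp (-k) * X) = X := by
      rw [← mul_assoc, ← Real.exp_add]; simp
    -- A range of length at least `T` already has the saving `φ(N) / N`. A shorter one is kept as a
    -- sum over `c ≤ T`; when the scales are summed first, `∑ exp k` over `exp k ≤ X / c` is at most
    -- `2 X / c`, which leaves the sum of `1 / φ(c)` up to `T` and hence a single `log T`.
    by_cases hk : T ≤ ⌊Real.exp (-k) * X⌋₊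
    · have h1 := sum_div_totient_le hN (hT.trans hk) (h.trans (by exact_mod_cast hk))
      have h2 : (⌊Real.exp (-k) * X⌋₊ : ℝ) ≤ Real.exp (-k) * X := Nat.floor_le (by positivity)
      have h3 : Real.exp k * ∑ c ∈ Ioc 0 ⌊Real.exp (-k) * X⌋₊ with c.Coprime N, g c ≤
          36 * Real.exp 7 * X * totientRatio N := by
        calc _ ≤ Real.exp k * (36 * Real.exp 7 * ⌊Real.exp (-k) * X⌋₊ * totientRatio N) := by
              gcongr
          _ ≤ Real.exp k * (36 * Real.exp 7 * (Real.exp (-k) * X) * totientRatio N) := by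
              gcongr
          _ = 36 * Real.exp 7 * (Real.exp k * (Real.exp (-k) * X)) * totientRatio N := by ring
          _ = _ := by rw [hXk]
      linarith
    · have h1 : Real.exp k * ∑ c ∈ Ioc 0 ⌊Real.exp (-k) * X⌋₊ with c.Coprime N, g c ≤
          ∑ c ∈ Ioc 0 T with c.Coprime N, g c * if Real.exp k ≤ X / c then Real.exp k else 0 := by
        have h2 : ∀ c ∈ (Ioc 0 ⌊Real.exp (-k) * X⌋₊).filter (fun c => c.Coprime N),
            Real.exp k * g c = g c * if Real.exp k ≤ X / c then Real.exp k else 0 := by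
          intro c hc
          rw [mem_filter, mem_Ioc] at hc
          have hc0 : (0 : ℝ) < c := by exact_mod_cast hc.1.1
          have h3 : (c : ℝ) ≤ Real.exp (-k) * X :=
            (Nat.le_floor_iff (by positivity)).1 hc.1.2
          rw [if_pos, mul_comm]
          rw [le_div_iff₀ hc0]
          calc _ ≤ Real.exp k * (Real.exp (-k) * X) := by gcongr
            _ = X := hXk
        rw [mul_sum, sum_congr rfl h2]
        refine sum_le_sum_of_subset_of_nonneg ?_ fun c _ _ => mul_nonneg (hg0 c) ?_
        · refine filter_subset_filter _ (Ioc_subset_Ioc_right (by omega))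
        · split_ifs <;> positivity
      have : 0 ≤ 36 * Real.exp 7 * X * totientRatio N := by positivity
      linarith
  have hsmall : ∑ k ∈ Icc 1 K, ∑ c ∈ Ioc 0 T with c.Coprime N,
      (g c * if Real.exp (k : ℕ) ≤ X / c then Real.exp k else 0) ≤
        2 * X * (3 * Real.exp 7 * Real.log T * totientRatio N) := by
    calc _ ≤ 2 * X * ∑ c ∈ Ioc 0 T with c.Coprime N, ((c.totient : ℝ))⁻¹ := by
          rw [sum_comm, mul_sum]
          refine sum_le_sum fun c hc => ?_
          have hc0 : (0 : ℝ) < c := by exact_mod_cast (mem_Ioc.1 (mem_filter.1 hc).1).1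
          rw [← mul_sum, ← sum_filter]
          calc _ ≤ g c * (2 * (X / c)) :=
                mul_le_mul_of_nonneg_left (sum_exp_filter_le K (by positivity)) (hg0 c)
            _ = _ := by simp only [hg]; field_simp
      _ ≤ _ := by
          gcongr
          exact sum_inv_totient_le hN hT h
  refine (sum_le_sum hterm).trans ?_
  rw [sum_add_distrib, sum_const, Nat.card_Icc, nsmul_eq_mul, Nat.add_sub_cancel]
  have h1 : 0 ≤ Real.exp 7 * Real.log T * X * totientRatio N := by positivity
  nlinarith

/-! ### Counting reduced fractions at a given distance -/

open Finset in
/-- An upper bound sieve for complete residue systems: at most `g * ∏ (1 - |S p| / p)` residues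
modulo `g` avoid the set `S p` of residues modulo `p` for every prime `p ∣ g`. -/
theorem card_range_avoiding_le {g : ℕ} (hg : g ≠ 0) (S : ∀ p : ℕ, Finset (ZMod p)) :
    ((#{t ∈ range g | ∀ p ∈ g.primeFactors, (t : ZMod p) ∉ S p} : ℕ) : ℝ) ≤
      g * ∏ p ∈ g.primeFactors, (1 - (#(S p) : ℝ) / p) := by
  set d := ∏ p ∈ g.primeFactors, p with hd
  have hdg : d ∣ g := Nat.prod_primeFactors_dvd g
  have hd0 : 0 < d := Nat.pos_of_dvd_of_pos hdg (Nat.pos_of_ne_zero hg)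
  have : ∀ p : g.primeFactors, NeZero (p : ℕ) :=
    fun p => ⟨(Nat.prime_of_mem_primeFactors p.2).ne_zero⟩
  let f : ℕ → ∀ p : g.primeFactors, ZMod p := fun t p => (t : ZMod p)
  -- Chinese remainder theorem: in `range g` the fibres of `t ↦ (t mod p)` over `p ∣ g` lie in
  -- single classes modulo the radical `d`, so they have at most `g / d` elements.
  have h1 := card_le_mul_card_image_of_maps_to
    (s := {t ∈ range g | ∀ p ∈ g.primeFactors, (t : ZMod p) ∉ S p})
    (t := Fintype.piFinset fun p : g.primeFactors => (S p)ᶜ) (f := f)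
    (fun t ht => by
      rw [Fintype.mem_piFinset]
      intro p
      rw [mem_compl]
      exact (mem_filter.1 ht).2 p p.2) (g / d) (fun y _ => by
      rw [← card_range (g / d)]
      refine card_le_card_of_injOn (fun t => t / d) ?_ ?_
      · intro t ht
        have ht' := mem_range.1 (mem_filter.1 (mem_filter.1 ht).1).1
        rw [mem_coe, mem_range]
        exact Nat.div_lt_div_of_lt_of_dvd hdg ht'
      · intro t ht u hu htu
        have ht' := (mem_filter.1 ht).2
        have hu' := (mem_filter.1 hu).2
        have hmod : t ≡ u [MOD d] := by
          rw [Nat.modEq_iff_dvd, hd, Nat.cast_prod]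
          refine prod_dvd_of_coprime (fun p hp q hq hpq => ?_) fun p hp => ?_
          · exact Nat.isCoprime_iff_coprime.2 ((Nat.coprime_primes
              (Nat.prime_of_mem_primeFactors hp) (Nat.prime_of_mem_primeFactors hq)).2 hpq)
          · rw [← Nat.modEq_iff_dvd, ← ZMod.natCast_eq_natCast_iff]
            have := congrFun (ht'.trans hu'.symm) ⟨p, hp⟩
            exact this
        rw [← Nat.div_add_mod t d, ← Nat.div_add_mod u d, hmod]
        simp only at htu
        rw [htu])
  have h2 : (#(Fintype.piFinset fun p : g.primeFactors => (S p)ᶜ) : ℝ) =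
      ∏ p ∈ g.primeFactors, ((p : ℝ) - #(S p)) := by
    rw [Fintype.card_piFinset, Nat.cast_prod, ← prod_coe_sort g.primeFactors]
    refine prod_congr rfl fun p _ => ?_
    rw [card_compl, ZMod.card, Nat.cast_sub]
    exact (card_le_univ _).trans_eq (ZMod.card p)
  have h3 : ∏ p ∈ g.primeFactors, ((p : ℝ) - #(S p)) =
      d * ∏ p ∈ g.primeFactors, (1 - (#(S p) : ℝ) / p) := by
    rw [hd, Nat.cast_prod, ← prod_mul_distrib]
    refine prod_congr rfl fun p hp => ?_
    have : (p : ℝ) ≠ 0 := by exact_mod_cast (Nat.prime_of_mem_primeFactors hp).ne_zero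
    field_simp
  have h4 : ((g / d : ℕ) : ℝ) * d = g := by exact_mod_cast Nat.div_mul_cancel hdg
  calc _ ≤ ((g / d : ℕ) : ℝ) * (#(Fintype.piFinset fun p : g.primeFactors => (S p)ᶜ) : ℝ) := by
        exact_mod_cast h1
    _ = _ := by rw [h2, h3, ← mul_assoc, h4]

-- This turns the local factors produced by the sieve into `φ(g m) φ(g n)`. The primes of `g m * (g
-- n)` split into those dividing `m n` and those dividing only `g`.
open Finset in
theorem totientRatio_mul_totientRatio {g m n : ℕ} (hg : g ≠ 0) (hm : m ≠ 0) (hn : n ≠ 0)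
    (h : m.Coprime n) :
    totientRatio (g * m) * totientRatio (g * n) = totientRatio g * totientRatio (m * n) *
      ∏ p ∈ g.primeFactors with ¬ p ∣ m * n, (1 - (p : ℝ)⁻¹) := by
  have hgcd : (g * m).gcd (g * n) = g := by rw [Nat.gcd_mul_left, h.gcd_eq_one, mul_one]
  have h1 := Nat.totient_gcd_mul_totient_mul (g * m) (g * n)
  rw [hgcd] at h1
  have h2 : totientRatio (g * m) * totientRatio (g * n) =
      totientRatio g * totientRatio (g * m * (g * n)) := by
    have h1' : (g.totient : ℝ) * (g * m * (g * n)).totient =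
      (g * m).totient * (g * n).totient * g := by exact_mod_cast h1
    have hg' : (g : ℝ) ≠ 0 := by exact_mod_cast hg
    have hm' : (m : ℝ) ≠ 0 := by exact_mod_cast hm
    have hn' : (n : ℝ) ≠ 0 := by exact_mod_cast hn
    simp only [totientRatio]
    push_cast
    field_simp
    rw [h1']
    ring
  rw [h2, mul_assoc (totientRatio g)]
  congr 1
  rw [totientRatio_eq_prod (by positivity), totientRatio_eq_prod (by positivity)]
  have h3 : (g * m * (g * n)).primeFactors =
      (m * n).primeFactors ∪ g.primeFactors.filter (fun p => ¬ p ∣ m * n) := by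
    ext p
    have e : g * m * (g * n) ≠ 0 := by positivity
    have e' : m * n ≠ 0 := by positivity
    simp only [mem_union, mem_filter, Nat.mem_primeFactors]
    constructor
    · rintro ⟨hp, hd, _⟩
      by_cases h : p ∣ m * n
      · exact Or.inl ⟨hp, h, e'⟩
      · refine Or.inr ⟨⟨hp, ?_, hg⟩, h⟩
        rw [show g * m * (g * n) = g * g * (m * n) by ring] at hd
        have := (hp.dvd_mul.1 hd).resolve_right h
        exact (hp.dvd_mul.1 this).elim id id
    · rintro (⟨hp, hd, _⟩ | ⟨⟨hp, hd, _⟩, _⟩)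
      · exact ⟨hp, hd.trans ⟨g * g, by ring⟩, e⟩
      · exact ⟨hp, hd.trans ⟨m * (g * n), by ring⟩, e⟩
  rw [h3, prod_union]
  rw [disjoint_left]
  intro p hp hp'
  exact (mem_filter.1 hp').2 (Nat.dvd_of_mem_primeFactors hp)

/-- The pairs of reduced residues `a` modulo `g * m` and `b` modulo `g * n` such that
`a * n - b * m` is congruent to `c` modulo `g * m * n`. -/
def residuePairs (g m n : ℕ) (c : ℤ) : Finset (ℕ × ℕ) :=
  {x ∈ Finset.range (g * m) ×ˢ Finset.range (g * n) |
    (x.1.Coprime (g * m) ∧ x.2.Coprime (g * n)) ∧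
      ((g * m * n : ℕ) : ℤ) ∣ (x.1 : ℤ) * n - x.2 * m - c}

theorem mem_residuePairs {g m n : ℕ} {c : ℤ} {x : ℕ × ℕ} :
    x ∈ residuePairs g m n c ↔ x.1 < g * m ∧ x.2 < g * n ∧ x.1.Coprime (g * m) ∧
      x.2.Coprime (g * n) ∧ ((g * m * n : ℕ) : ℤ) ∣ (x.1 : ℤ) * n - x.2 * m - c := by
  simp only [residuePairs, Finset.mem_filter, Finset.mem_product, Finset.mem_range]
  tauto

/-- A prime dividing `c` and `m` would divide `a n`, hence `a`, against `a` being reduced modulo `g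
m`; the case of `n` is symmetric. This restriction on `c` is the source of the saving `φ(m n) / (m
n)`. -/
theorem coprime_of_mem_residuePairs {g m n : ℕ} (h : m.Coprime n) {c : ℤ} {x : ℕ × ℕ}
    (hx : x ∈ residuePairs g m n c) : c.natAbs.Coprime (m * n) := by
  obtain ⟨-, -, h3, h4, h5⟩ := mem_residuePairs.1 hx
  refine Nat.Coprime.mul_right ?_ ?_
  · refine Nat.coprime_of_dvd fun p hp hpc hpm => ?_
    have hpn : ¬ p ∣ n := fun hpn => hp.one_lt.ne' (Nat.eq_one_of_dvd_coprimes h hpm hpn)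
    have h6 : (p : ℤ) ∣ (x.1 : ℤ) * n - x.2 * m - c :=
      (Int.natCast_dvd_natCast.2 (hpm.trans ⟨g * n, by ring⟩)).trans h5
    have h7 : (p : ℤ) ∣ (x.1 : ℤ) * n := by
      have e : (x.1 : ℤ) * n = ((x.1 : ℤ) * n - x.2 * m - c) + x.2 * m + c := by ring
      rw [e]
      exact dvd_add (dvd_add h6 (Dvd.dvd.mul_left (Int.natCast_dvd_natCast.2 hpm) _))
        (Int.natCast_dvd.2 hpc)
    have h8 : p ∣ x.1 * n := by exact_mod_cast h7
    exact hp.one_lt.ne' (Nat.eq_one_of_dvd_coprimes h3 ((hp.dvd_mul.1 h8).resolve_right hpn)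
      (hpm.trans ⟨g, by ring⟩))
  · refine Nat.coprime_of_dvd fun p hp hpc hpn => ?_
    have hpm : ¬ p ∣ m := fun hpm => hp.one_lt.ne' (Nat.eq_one_of_dvd_coprimes h hpm hpn)
    have h6 : (p : ℤ) ∣ (x.1 : ℤ) * n - x.2 * m - c :=
      (Int.natCast_dvd_natCast.2 (hpn.trans ⟨g * m, by ring⟩)).trans h5
    have h7 : (p : ℤ) ∣ (x.2 : ℤ) * m := by
      have e : (x.2 : ℤ) * m = x.1 * n - ((x.1 : ℤ) * n - x.2 * m - c) - c := by ring
      rw [e]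
      exact dvd_sub (dvd_sub (Dvd.dvd.mul_left (Int.natCast_dvd_natCast.2 hpn) _) h6)
        (Int.natCast_dvd.2 hpc)
    have h8 : p ∣ x.2 * m := by exact_mod_cast h7
    exact hp.one_lt.ne' (Nat.eq_one_of_dvd_coprimes h4 ((hp.dvd_mul.1 h8).resolve_right hpm)
      (hpn.trans ⟨g, by ring⟩))

/-- Subtracting the two congruences shows that `m` divides the difference of the first entries and
`n` that of the second; the two quotients agree modulo `g`. -/
theorem exists_shift_of_mem_residuePairs {g m n : ℕ} (hg : 0 < g) (hm : 0 < m) (hn : 0 < n)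
    (h : m.Coprime n) {c : ℤ} {x y : ℕ × ℕ}
    (hx : x ∈ residuePairs g m n c) (hy : y ∈ residuePairs g m n c) :
    ∃ t < g, ((g * m : ℕ) : ℤ) ∣ (x.1 : ℤ) - (y.1 + m * t) ∧
      ((g * n : ℕ) : ℤ) ∣ (x.2 : ℤ) - (y.2 + n * t) := by
  obtain ⟨-, -, -, -, hx⟩ := mem_residuePairs.1 hx
  obtain ⟨-, -, -, -, hy⟩ := mem_residuePairs.1 hy
  have hc : IsCoprime (m : ℤ) n := Nat.isCoprime_iff_coprime.2 h
  obtain ⟨w, hw⟩ := dvd_sub hx hy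
  have e : ((x.1 : ℤ) - y.1) * n - (x.2 - y.2) * m = g * m * n * w := by
    push_cast at hw; linarith
  obtain ⟨s, hs⟩ : (m : ℤ) ∣ x.1 - y.1 := by
    refine hc.dvd_of_dvd_mul_right ⟨g * n * w + (x.2 - y.2), ?_⟩
    linear_combination e
  obtain ⟨u, hu⟩ : (n : ℤ) ∣ x.2 - y.2 := by
    refine hc.symm.dvd_of_dvd_mul_right ⟨(x.1 - y.1) - g * m * w, ?_⟩
    linear_combination -e
  have hm' : (m : ℤ) ≠ 0 := by exact_mod_cast hm.ne'
  have hn' : (n : ℤ) ≠ 0 := by exact_mod_cast hn.ne'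
  have hsu : s = u + g * w := by
    rw [hs, hu] at e
    have : (m * n : ℤ) * (s - u - g * w) = 0 := by linear_combination e
    have := (mul_eq_zero.1 this).resolve_left (mul_ne_zero hm' hn')
    linarith
  have hg' : (0 : ℤ) < g := by exact_mod_cast hg
  have h1 := Int.emod_nonneg s hg'.ne'
  have h2 := Int.emod_lt_of_pos s hg'
  have h3 : ((s % g).toNat : ℤ) = s % g := Int.toNat_of_nonneg h1
  have h4 := Int.emod_add_mul_ediv s g
  refine ⟨(s % g).toNat, by omega, ⟨s / g, ?_⟩, ⟨s / g - w, ?_⟩⟩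
  · rw [h3]; push_cast
    linear_combination hs - m * h4
  · rw [h3]; push_cast
    linear_combination hu - n * h4 - n * hsu

-- Fix one solution `(a, b)` and parametrise the others by the shift `t` modulo `g`. For `p ∣ g`,
-- coprimality forbids `t ≡ -a / m` if `p ∤ m` and `t ≡ -b / n` if `p ∤ n`. At least one class is
-- excluded, as `p` cannot divide both. If `p ∤ m n c` the two classes differ, since equality would
-- give `p ∣ a n - b m ≡ c`; then `1 - 2 / p ≤ (1 - 1 / p) ^ 2`. Restoring the second factor at the
-- primes dividing `c` costs `c / φ(c)`.
open Finset in
theorem card_residuePairs_mul_le {g m n : ℕ} (hg : 0 < g) (hm : 0 < m) (hn : 0 < n)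
    (h : m.Coprime n) {c : ℤ} (hc : c ≠ 0) :
    (#(residuePairs g m n c) : ℝ) * totientRatio (m * n) ≤
      g * (totientRatio (g * m) * totientRatio (g * n)) *
        if c.natAbs.Coprime (m * n) then (c.natAbs : ℝ) / c.natAbs.totient else 0 := by
  rcases (residuePairs g m n c).eq_empty_or_nonempty with he | ⟨y, hy⟩
  · rw [he]
    have h1 := totientRatio_pos (n := g * m) (by positivity)
    have h2 := totientRatio_pos (n := g * n) (by positivity)
    simp only [card_empty, Nat.cast_zero, zero_mul]
    split_ifs <;> positivity
  rw [if_pos (coprime_of_mem_residuePairs h hy)]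
  obtain ⟨-, -, -, -, hydvd⟩ := mem_residuePairs.1 hy
  let S : ∀ p : ℕ, Finset (ZMod p) := fun p =>
    (if p ∣ m then ∅ else {-(y.1 : ZMod p) * (m : ZMod p)⁻¹}) ∪
      (if p ∣ n then ∅ else {-(y.2 : ZMod p) * (n : ZMod p)⁻¹})
  choose! t ht using fun x (hx : x ∈ residuePairs g m n c) =>
    exists_shift_of_mem_residuePairs hg hm hn h hx hy
  have hcard : #(residuePairs g m n c) ≤
      #{t ∈ range g | ∀ p ∈ g.primeFactors, (t : ZMod p) ∉ S p} := by
    refine card_le_card_of_injOn t ?_ ?_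
    · intro x hx
      obtain ⟨ht1, ht2, ht3⟩ := ht x hx
      obtain ⟨-, -, hx1, hx2, -⟩ := mem_residuePairs.1 hx
      rw [mem_coe, mem_filter, mem_range]
      refine ⟨ht1, fun p hp hmem => ?_⟩
      have hpp := Nat.prime_of_mem_primeFactors hp
      have hpg := Nat.dvd_of_mem_primeFactors hp
      have : Fact p.Prime := ⟨hpp⟩
      rcases mem_union.1 hmem with hmem | hmem
      · split_ifs at hmem with hpm
        · simp at hmem
        · rw [mem_singleton] at hmem
          have hm0 : (m : ZMod p) ≠ 0 := by rwa [Ne, ZMod.natCast_eq_zero_iff]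
          have h1 : (p : ℤ) ∣ (x.1 : ℤ) - (y.1 + m * t x) :=
            (Int.natCast_dvd_natCast.2 (hpg.mul_right m)).trans ht2
          rw [← ZMod.intCast_zmod_eq_zero_iff_dvd] at h1
          push_cast at h1
          rw [hmem] at h1
          have h2 : (x.1 : ZMod p) = 0 := by
            field_simp at h1
            linear_combination h1
          rw [ZMod.natCast_eq_zero_iff] at h2
          exact hpp.one_lt.ne' (Nat.eq_one_of_dvd_coprimes hx1 h2 (hpg.mul_right m))
      · split_ifs at hmem with hpn
        · simp at hmem
        · rw [mem_singleton] at hmem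
          have hn0 : (n : ZMod p) ≠ 0 := by rwa [Ne, ZMod.natCast_eq_zero_iff]
          have h1 : (p : ℤ) ∣ (x.2 : ℤ) - (y.2 + n * t x) :=
            (Int.natCast_dvd_natCast.2 (hpg.mul_right n)).trans ht3
          rw [← ZMod.intCast_zmod_eq_zero_iff_dvd] at h1
          push_cast at h1
          rw [hmem] at h1
          have h2 : (x.2 : ZMod p) = 0 := by
            field_simp at h1
            linear_combination h1
          rw [ZMod.natCast_eq_zero_iff] at h2
          exact hpp.one_lt.ne' (Nat.eq_one_of_dvd_coprimes hx2 h2 (hpg.mul_right n))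
    · intro x hx z hz hxz
      obtain ⟨-, hx1, hx2⟩ := ht x hx
      obtain ⟨-, hz1, hz2⟩ := ht z hz
      obtain ⟨hx3, hx4, -, -, -⟩ := mem_residuePairs.1 hx
      obtain ⟨hz3, hz4, -, -, -⟩ := mem_residuePairs.1 hz
      have e1 : z.1 ≡ x.1 [MOD g * m] := by
        rw [Nat.modEq_iff_dvd]
        have e := dvd_sub hx1 hz1
        rw [hxz, sub_sub_sub_cancel_right] at e
        exact e
      have e2 : z.2 ≡ x.2 [MOD g * n] := by
        rw [Nat.modEq_iff_dvd]
        have e := dvd_sub hx2 hz2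
        rw [hxz, sub_sub_sub_cancel_right] at e
        exact e
      exact Prod.ext (Nat.ModEq.eq_of_lt_of_lt e1.symm hx3 hz3)
        (Nat.ModEq.eq_of_lt_of_lt e2.symm hx4 hz4)
  have hS : ∀ p ∈ g.primeFactors, 1 - (#(S p) : ℝ) / p ≤
      (1 - (p : ℝ)⁻¹) * if ¬ p ∣ m * n ∧ ¬ (p : ℤ) ∣ c then (1 - (p : ℝ)⁻¹) else 1 := by
    intro p hp
    have hpp := Nat.prime_of_mem_primeFactors hp
    have hpg := Nat.dvd_of_mem_primeFactors hp
    have : Fact p.Prime := ⟨hpp⟩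
    have hp0 : (0 : ℝ) < p := by exact_mod_cast hpp.pos
    have hpi : (0 : ℝ) < (p : ℝ)⁻¹ := by positivity
    have hone : 1 ≤ #(S p) := by
      rw [Nat.one_le_iff_ne_zero, Ne, card_eq_zero]
      intro hempty
      obtain ⟨h1, h2⟩ := union_eq_empty.1 hempty
      split_ifs at h1 h2 with hpm hpn
      · exact hpp.one_lt.ne' (Nat.eq_one_of_dvd_coprimes h hpm hpn)
      · simp at h2
      · simp at h1
      · simp at h1
    rw [div_eq_mul_inv]
    split_ifs with hcase
    · obtain ⟨hpmn, hpc⟩ := hcase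
      have hpm : ¬ p ∣ m := fun h => hpmn (h.mul_right n)
      have hpn : ¬ p ∣ n := fun h => hpmn (h.mul_left m)
      have hm0 : (m : ZMod p) ≠ 0 := by rwa [Ne, ZMod.natCast_eq_zero_iff]
      have hn0 : (n : ZMod p) ≠ 0 := by rwa [Ne, ZMod.natCast_eq_zero_iff]
      have htwo : #(S p) = 2 := by
        have hSp : S p = {-(y.1 : ZMod p) * (m : ZMod p)⁻¹, -(y.2 : ZMod p) * (n : ZMod p)⁻¹} := by
          simp only [S, if_neg hpm, if_neg hpn]
          rfl
        rw [hSp]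
        refine card_pair fun heq => hpc ?_
        have h1 : (p : ℤ) ∣ (y.1 : ℤ) * n - y.2 * m - c :=
          (Int.natCast_dvd_natCast.2 (hpg.trans ⟨m * n, by ring⟩)).trans hydvd
        have h2 : (p : ℤ) ∣ (y.1 : ℤ) * n - y.2 * m := by
          rw [← ZMod.intCast_zmod_eq_zero_iff_dvd]
          push_cast
          field_simp at heq
          linear_combination -heq
        have e := dvd_sub h2 h1
        rwa [sub_sub_cancel] at e
      rw [htwo]
      push_cast
      nlinarith
    · have : (1 : ℝ) ≤ #(S p) := by exact_mod_cast hone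
      nlinarith
  have hSnn : ∀ p ∈ g.primeFactors, 0 ≤ 1 - (#(S p) : ℝ) / p := by
    intro p hp
    have : NeZero p := ⟨(Nat.prime_of_mem_primeFactors hp).ne_zero⟩
    have hp0 : (0 : ℝ) < p := by exact_mod_cast (Nat.prime_of_mem_primeFactors hp).pos
    have h1 : #(S p) ≤ p := (card_le_univ _).trans_eq (ZMod.card p)
    rw [sub_nonneg, div_le_one hp0]
    exact_mod_cast h1
  have hpos : ∀ p ∈ g.primeFactors, (0 : ℝ) < 1 - (p : ℝ)⁻¹ := fun p hp =>
    one_sub_inv_pos (Nat.prime_of_mem_primeFactors hp)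
  set A := ∏ p ∈ g.primeFactors with ¬ p ∣ m * n ∧ ¬ (p : ℤ) ∣ c, (1 - (p : ℝ)⁻¹) with hA
  set B := ∏ p ∈ g.primeFactors with ¬ p ∣ m * n, (1 - (p : ℝ)⁻¹) with hB
  have hcn : c.natAbs ≠ 0 := Int.natAbs_ne_zero.2 hc
  have hAB : A * totientRatio c.natAbs ≤ B := by
    have h1 : B = A * ∏ p ∈ g.primeFactors with ¬ p ∣ m * n ∧ (p : ℤ) ∣ c, (1 - (p : ℝ)⁻¹) := by
      rw [hA, hB, ← prod_filter_mul_prod_filter_not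
        (g.primeFactors.filter fun p => ¬ p ∣ m * n) (fun p => ¬ (p : ℤ) ∣ c)]
      simp only [filter_filter, not_not]
    rw [h1]
    refine mul_le_mul_of_nonneg_left ?_ (prod_nonneg fun p hp => (hpos p (mem_filter.1 hp).1).le)
    rw [totientRatio_eq_prod hcn]
    have hsub : g.primeFactors.filter (fun p => ¬ p ∣ m * n ∧ (p : ℤ) ∣ c) ⊆
        c.natAbs.primeFactors := by
      intro p hp
      obtain ⟨h2, h3, h4⟩ := mem_filter.1 hp
      rw [Nat.mem_primeFactors]
      exact ⟨Nat.prime_of_mem_primeFactors h2, Int.natCast_dvd.1 h4, hcn⟩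
    rw [← prod_sdiff hsub]
    refine mul_le_of_le_one_left (prod_nonneg fun p hp => (hpos p (mem_filter.1 hp).1).le) ?_
    refine prod_le_one (fun p hp => ?_) fun p hp => ?_
    · exact (one_sub_inv_pos (Nat.prime_of_mem_primeFactors (mem_sdiff.1 hp).1)).le
    · have : (0 : ℝ) ≤ (p : ℝ)⁻¹ := by positivity
      linarith
  have hR : (#(residuePairs g m n c) : ℝ) ≤ g * (totientRatio g * A) := by
    calc (#(residuePairs g m n c) : ℝ) ≤
        ((#{t ∈ range g | ∀ p ∈ g.primeFactors, (t : ZMod p) ∉ S p} : ℕ) : ℝ) := by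
          exact_mod_cast hcard
      _ ≤ g * ∏ p ∈ g.primeFactors, (1 - (#(S p) : ℝ) / p) := card_range_avoiding_le hg.ne' S
      _ ≤ g * ∏ p ∈ g.primeFactors, ((1 - (p : ℝ)⁻¹) *
            if ¬ p ∣ m * n ∧ ¬ (p : ℤ) ∣ c then (1 - (p : ℝ)⁻¹) else 1) := by
          refine mul_le_mul_of_nonneg_left (prod_le_prod hSnn hS) (by positivity)
      _ = _ := by
          rw [prod_mul_distrib, totientRatio_eq_prod hg.ne', hA, prod_filter]
  rw [totientRatio_mul_totientRatio hg.ne' hm.ne' hn.ne' h]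
  have hN := totientRatio_pos (n := m * n) (by positivity)
  have hgr := totientRatio_pos hg.ne'
  have hcr := totientRatio_pos hcn
  have hinv : (c.natAbs : ℝ) / c.natAbs.totient = (totientRatio c.natAbs)⁻¹ := by
    rw [totientRatio, inv_div]
  rw [hinv]
  have hAB' : A ≤ B * (totientRatio c.natAbs)⁻¹ := by
    rwa [← div_eq_mul_inv, le_div_iff₀ hcr]
  calc _ ≤ g * (totientRatio g * A) * totientRatio (m * n) := by gcongr
    _ ≤ g * (totientRatio g * (B * (totientRatio c.natAbs)⁻¹)) * totientRatio (m * n) := by gcongr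
    _ = _ := by ring

open Finset in
/-- The number of pairs of distinct reduced fractions with denominators `g * m` and `g * n` whose
distance modulo one is less than `η`. -/
theorem card_close_fractions_mul_le {g m n : ℕ} (hg : 0 < g) (hm : 0 < m) (hn : 0 < n)
    (h : m.Coprime n) {η : ℝ} (Q : Finset (ℕ × ℕ))
    (hQ : ∀ x ∈ Q, x.1 < g * m ∧ x.2 < g * n ∧ x.1.Coprime (g * m) ∧ x.2.Coprime (g * n) ∧
      (g * m, x.1) ≠ (g * n, x.2) ∧
      ‖(((x.1 : ℝ) / (g * m : ℕ) - (x.2 : ℝ) / (g * n : ℕ) : ℝ) : UnitAddCircle)‖ < η) :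
    (#Q : ℝ) * totientRatio (m * n) ≤
      2 * (g * (totientRatio (g * m) * totientRatio (g * n)) *
        ∑ c ∈ Ioc 0 ⌊(g * m * n : ℕ) * η⌋₊ with c.Coprime (m * n), (c : ℝ) / c.totient) := by
  have hsub : Q ⊆ (Ioc 0 ⌊(g * m * n : ℕ) * η⌋₊).biUnion
      fun c => residuePairs g m n c ∪ residuePairs g m n (-c) := by
    rintro ⟨a, b⟩ hx
    obtain ⟨h1, h2, h3, h4, h5, h6⟩ := hQ _ hx
    simp only at h1 h2 h3 h4 h5 h6
    rw [UnitAddCircle.norm_eq] at h6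
    set z : ℤ := round ((a : ℝ) / (g * m : ℕ) - (b : ℝ) / (g * n : ℕ)) with hz
    set c : ℤ := (a : ℤ) * n - b * m - z * (g * m * n : ℕ) with hc
    have hg' : (0 : ℝ) < g := by exact_mod_cast hg
    have hm' : (0 : ℝ) < m := by exact_mod_cast hm
    have hn' : (0 : ℝ) < n := by exact_mod_cast hn
    have hcr : (c : ℝ) = (g * m * n : ℕ) * ((a : ℝ) / (g * m : ℕ) - (b : ℝ) / (g * n : ℕ) - z) := by
      rw [hc]; push_cast; field_simp
    have hcabs : (c.natAbs : ℝ) < (g * m * n : ℕ) * η := by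
      rw [Nat.cast_natAbs, Int.cast_abs, hcr, abs_mul, Nat.abs_cast]
      exact mul_lt_mul_of_pos_left h6 (by exact_mod_cast by positivity)
    have hdvd : ((g * m * n : ℕ) : ℤ) ∣ (a : ℤ) * n - b * m - c := ⟨z, by rw [hc]; ring⟩
    have hmem : (a, b) ∈ residuePairs g m n c := mem_residuePairs.2 ⟨h1, h2, h3, h4, hdvd⟩
    -- Zero is coprime to `m n` only when `m = n = 1`; then the fractions share the denominator `g`
    -- and have congruent numerators, so they coincide.
    have hc0 : c ≠ 0 := by
      intro hc0
      have hcop := coprime_of_mem_residuePairs h hmem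
      rw [hc0, Int.natAbs_zero, Nat.coprime_zero_left] at hcop
      obtain ⟨rfl, rfl⟩ := mul_eq_one.1 hcop
      rw [hc0] at hdvd
      simp only [mul_one, Nat.cast_one, sub_zero] at hdvd h1 h2 h5
      have : b ≡ a [MOD g] := by
        rw [Nat.modEq_iff_dvd]; exact hdvd
      exact h5 (by rw [Nat.ModEq.eq_of_lt_of_lt this h2 h1])
    rw [mem_biUnion]
    refine ⟨c.natAbs, ?_, ?_⟩
    · rw [mem_Ioc]
      exact ⟨Int.natAbs_pos.2 hc0, Nat.le_floor hcabs.le⟩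
    · rw [mem_union]
      rcases Int.natAbs_eq c with hs | hs
      · left; rw [← hs]; exact hmem
      · right
        rw [← hs]; exact hmem
  have hcard : (#Q : ℝ) ≤ ∑ c ∈ Ioc 0 ⌊(g * m * n : ℕ) * η⌋₊,
      ((#(residuePairs g m n c) : ℝ) + #(residuePairs g m n (-c))) := by
    have h1 := (card_le_card hsub).trans card_biUnion_le
    have h2 : #Q ≤ ∑ c ∈ Ioc 0 ⌊(g * m * n : ℕ) * η⌋₊,
        (#(residuePairs g m n c) + #(residuePairs g m n (-c))) :=
      h1.trans (sum_le_sum fun c _ => card_union_le _ _)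
    exact_mod_cast h2
  have hN := totientRatio_pos (n := m * n) (by positivity)
  refine (mul_le_mul_of_nonneg_right hcard hN.le).trans ?_
  rw [sum_mul, ← mul_assoc, mul_sum, sum_filter]
  refine sum_le_sum fun c hc => ?_
  have hc0 : (c : ℤ) ≠ 0 := by exact_mod_cast (mem_Ioc.1 hc).1.ne'
  have h1 := card_residuePairs_mul_le hg hm hn h hc0
  have h2 := card_residuePairs_mul_le hg hm hn h (neg_ne_zero.2 hc0)
  rw [Int.natAbs_neg] at h2
  rw [Int.natAbs_natCast] at h1 h2
  have h3 : (if c.Coprime (m * n) then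
      2 * (g * (totientRatio (g * m) * totientRatio (g * n))) * ((c : ℝ) / c.totient) else 0) =
      2 * (g * (totientRatio (g * m) * totientRatio (g * n)) *
        if c.Coprime (m * n) then (c : ℝ) / c.totient else 0) := by
    split_ifs <;> ring
  rw [h3]
  linarith

/-! ### Second moment method and overlaps of balls -/

open MeasureTheory Finset in
/-- The Chung–Erdős inequality. -/
theorem sq_sum_measureReal_le {Ω ι : Type*} [MeasurableSpace Ω] (μ : Measure Ω)
    [IsFiniteMeasure μ] (I : Finset ι) (A : ι → Set Ω) (hA : ∀ i ∈ I, MeasurableSet (A i)) :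
    (∑ i ∈ I, μ.real (A i)) ^ 2 ≤
      μ.real (⋃ i ∈ I, A i) * ∑ i ∈ I, ∑ j ∈ I, μ.real (A i ∩ A j) := by
  set U := ⋃ i ∈ I, A i with hU
  have hUm : MeasurableSet U := I.measurableSet_biUnion hA
  set F : Ω → ℝ := fun x => ∑ i ∈ I, (A i).indicator 1 x with hF
  have hint : ∀ s : Set Ω, MeasurableSet s → Integrable (s.indicator (1 : Ω → ℝ)) μ :=
    fun s hs => (integrable_const (1 : ℝ)).indicator hs
  have hmul : ∀ (s t : Set Ω) (x : Ω), s.indicator (1 : Ω → ℝ) x * t.indicator (1 : Ω → ℝ) x =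
      (s ∩ t).indicator 1 x := by
    intro s t x
    by_cases hs : x ∈ s <;> by_cases ht : x ∈ t <;> simp [hs, ht]
  -- The integral of `(F - r 1_U) ^ 2` is nonnegative for every `r`, so this quadratic in `r` has
  -- nonpositive discriminant, which is the claim.
  have key : ∀ r : ℝ, 0 ≤ (∑ i ∈ I, ∑ j ∈ I, μ.real (A i ∩ A j)) -
      2 * r * (∑ i ∈ I, μ.real (A i)) + r ^ 2 * μ.real U := by
    intro r
    have h1 : 0 ≤ ∫ x, (F x - r * U.indicator 1 x) ^ 2 ∂μ :=
      integral_nonneg fun x => sq_nonneg _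
    have h2 : ∀ x, (F x - r * U.indicator 1 x) ^ 2 =
        (∑ i ∈ I, ∑ j ∈ I, (A i ∩ A j).indicator (1 : Ω → ℝ) x) -
          2 * r * (∑ i ∈ I, (A i).indicator (1 : Ω → ℝ) x) + r ^ 2 * U.indicator 1 x := by
      intro x
      have h3 : F x * F x = ∑ i ∈ I, ∑ j ∈ I, (A i ∩ A j).indicator (1 : Ω → ℝ) x := by
        simp only [hF, sum_mul_sum, hmul]
      have h4 : F x * U.indicator 1 x = F x := by
        simp only [hF, sum_mul, hmul]
        refine sum_congr rfl fun i hi => ?_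
        have h5 : A i ⊆ U := Set.subset_iUnion₂ (s := fun i (_ : i ∈ I) => A i) i hi
        rw [Set.inter_eq_left.2 h5]
      have h5 : U.indicator (1 : Ω → ℝ) x * U.indicator 1 x = U.indicator 1 x := by
        rw [hmul, Set.inter_self]
      rw [← h3]
      linear_combination (-2 * r) * h4 + r ^ 2 * h5
    simp_rw [h2] at h1
    have i1 : Integrable (fun x => ∑ i ∈ I, ∑ j ∈ I, (A i ∩ A j).indicator (1 : Ω → ℝ) x) μ :=
      integrable_finsetSum _ fun i hi => integrable_finsetSum _ fun j hj =>
        hint _ ((hA i hi).inter (hA j hj))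
    have i2 : Integrable (fun x => ∑ i ∈ I, (A i).indicator (1 : Ω → ℝ) x) μ :=
      integrable_finsetSum _ fun i hi => hint _ (hA i hi)
    rw [integral_add (f := fun x => (∑ i ∈ I, ∑ j ∈ I, (A i ∩ A j).indicator (1 : Ω → ℝ) x) -
          2 * r * (∑ i ∈ I, (A i).indicator (1 : Ω → ℝ) x))
        (i1.sub (i2.const_mul _)) ((hint U hUm).const_mul _),
      integral_sub i1 (i2.const_mul _), integral_const_mul, integral_const_mul,
      integral_indicator_one hUm, integral_finsetSum _ fun i hi => hint _ (hA i hi),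
      integral_finsetSum _ fun i hi => integrable_finsetSum _ fun j hj =>
        hint _ ((hA i hi).inter (hA j hj))] at h1
    have e1 : ∑ i ∈ I, ∫ x, (A i).indicator (1 : Ω → ℝ) x ∂μ = ∑ i ∈ I, μ.real (A i) :=
      sum_congr rfl fun i hi => integral_indicator_one (hA i hi)
    have e2 : ∑ i ∈ I, ∫ x, ∑ j ∈ I, (A i ∩ A j).indicator (1 : Ω → ℝ) x ∂μ =
        ∑ i ∈ I, ∑ j ∈ I, μ.real (A i ∩ A j) := by
      refine sum_congr rfl fun i hi => ?_
      rw [integral_finsetSum _ fun j hj => hint _ ((hA i hi).inter (hA j hj))]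
      exact sum_congr rfl fun j hj => integral_indicator_one ((hA i hi).inter (hA j hj))
    rw [e1, e2] at h1
    exact h1
  have := discrim_le_zero (a := μ.real U) (b := -(2 * ∑ i ∈ I, μ.real (A i)))
    (c := ∑ i ∈ I, ∑ j ∈ I, μ.real (A i ∩ A j)) fun r => by linarith [key r]
  rw [discrim] at this
  nlinarith

/-- The pairs `(a, b)` of reduced residues modulo `m` and `n` such that the fractions `a / m` and
`b / n` are distinct and closer than `η` modulo one. -/
noncomputable def closePairs (m n : ℕ) (η : ℝ) : Finset (ℕ × ℕ) :=
  {x ∈ Finset.range m ×ˢ Finset.range n | (x.1.Coprime m ∧ x.2.Coprime n) ∧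
    (m, x.1) ≠ (n, x.2) ∧ ‖(((x.1 : ℝ) / m - (x.2 : ℝ) / n : ℝ) : UnitAddCircle)‖ < η}

-- After extracting the gcd, the factor `φ(m n) / (m n)` lost in the count for fixed `c` is regained
-- from the sum over `c`, leaving the independent size `φ(m) φ(n) η`.
open Finset in
theorem sum_scales_card_closePairs_le {m n T : ℕ} (hm : 0 < m) (hn : 0 < n) (hT : 2 ≤ T)
    (h : Real.log (m * n : ℕ) ≤ T) {η : ℝ} (hη : 0 ≤ η) (K : ℕ) :
    ∑ k ∈ Icc 1 K, Real.exp k * #(closePairs m n (Real.exp (-k) * η)) ≤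
      72 * Real.exp 7 * (K + Real.log T) * (m.totient * n.totient * η) := by
  obtain ⟨g, m, n, hg, hcop, rfl, rfl⟩ :=
    Nat.exists_coprime' (m := m) (n := n) (Nat.gcd_pos_of_pos_left n hm)
  rw [mul_comm m g, mul_comm n g] at *
  have hm' : 0 < m := Nat.pos_of_mul_pos_left hm
  have hn' : 0 < n := Nat.pos_of_mul_pos_left hn
  have hN := totientRatio_pos (n := m * n) (by positivity)
  have hlog : Real.log (m * n : ℕ) ≤ T := by
    refine le_trans (Real.log_le_log (by positivity) ?_) h
    exact_mod_cast Nat.mul_le_mul (Nat.le_mul_of_pos_left m hg) (Nat.le_mul_of_pos_left n hg)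
  set D : ℝ := g * (totientRatio (g * m) * totientRatio (g * n)) with hD
  have hD0 : 0 ≤ D := by
    have h1 := totientRatio_pos hm.ne'
    have h2 := totientRatio_pos hn.ne'
    positivity
  set X : ℝ := (g * m * n : ℕ) * η with hX
  have hX0 : 0 ≤ X := by positivity
  have hDX : D * X = (g * m).totient * (g * n).totient * η := by
    have hg' : (g : ℝ) ≠ 0 := by exact_mod_cast hg.ne'
    have hm'' : (m : ℝ) ≠ 0 := by exact_mod_cast hm'.ne'
    have hn'' : (n : ℝ) ≠ 0 := by exact_mod_cast hn'.ne'
    simp only [hD, hX, totientRatio]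
    push_cast
    field_simp
  have hmain := sum_scales_div_totient_le (N := m * n) (by positivity) hT hlog hX0 K
  refine le_of_mul_le_mul_right (a := totientRatio (m * n)) ?_ hN
  calc _ = ∑ k ∈ Icc 1 K, Real.exp k *
        (#(closePairs (g * m) (g * n) (Real.exp (-k) * η)) * totientRatio (m * n)) := by
        rw [sum_mul]
        exact sum_congr rfl fun k _ => by ring
    _ ≤ ∑ k ∈ Icc 1 K, Real.exp k * (2 * (D * ∑ c ∈ Ioc 0 ⌊Real.exp (-k) * X⌋₊
          with c.Coprime (m * n), (c : ℝ) / c.totient)) := by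
        refine sum_le_sum fun k _ => mul_le_mul_of_nonneg_left ?_ (Real.exp_pos _).le
        have h1 := card_close_fractions_mul_le hg hm' hn' hcop
          (η := Real.exp (-k) * η) (closePairs (g * m) (g * n) (Real.exp (-k) * η)) fun x hx => by
            simp only [closePairs, mem_filter, mem_product, mem_range] at hx
            tauto
        rwa [mul_left_comm _ (Real.exp (-k)) η] at h1
    _ = 2 * D * ∑ k ∈ Icc 1 K, Real.exp k * ∑ c ∈ Ioc 0 ⌊Real.exp (-k) * X⌋₊
          with c.Coprime (m * n), (c : ℝ) / c.totient := by
        rw [mul_sum]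
        exact sum_congr rfl fun k _ => by ring
    _ ≤ 2 * D * (36 * Real.exp 7 * (K + Real.log T) * X * totientRatio (m * n)) := by gcongr
    _ = 72 * Real.exp 7 * (K + Real.log T) * (D * X) * totientRatio (m * n) := by ring
    _ = _ := by rw [hDX]

open MeasureTheory in
theorem volume_real_ball {x : UnitAddCircle} {δ : ℝ} (h0 : 0 ≤ δ) (h1 : 2 * δ ≤ 1) :
    (volume : Measure UnitAddCircle).real (Metric.ball x δ) = 2 * δ := by
  rw [measureReal_def, ← measure_congr AddCircle.closedBall_ae_eq_ball,
    AddCircle.volume_closedBall, min_eq_right h1, ENNReal.toReal_ofReal (by linarith)]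

open MeasureTheory in
theorem volume_real_ball_inter_le {x y : UnitAddCircle} {δ ε : ℝ} (hδ : 0 ≤ δ) (hε : 0 ≤ ε)
    (hδ1 : 2 * δ ≤ 1) (hε1 : 2 * ε ≤ 1) :
    (volume : Measure UnitAddCircle).real (Metric.ball x δ ∩ Metric.ball y ε) ≤
      if ‖x - y‖ < δ + ε then 2 * min δ ε else 0 := by
  split_ifs with h
  · rw [mul_min_of_nonneg _ _ zero_le_two, le_min_iff, ← volume_real_ball (x := x) hδ hδ1,
      ← volume_real_ball (x := y) hε hε1]
    exact ⟨measureReal_mono Set.inter_subset_left, measureReal_mono Set.inter_subset_right⟩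
  · rw [← dist_eq_norm, not_lt, add_comm] at h
    rw [(Metric.ball_disjoint_ball (by rwa [add_comm] at h)).inter_eq]
    simp

/-- The reduced fractions in `[0, 1)` with denominator in `B`, as pairs of the denominator and the
numerator. -/
def reducedFractions (B : Finset ℕ) : Finset (Σ _ : ℕ, ℕ) :=
  B.sigma fun n => (Finset.range n).filter fun a => a.Coprime n

open Finset in
theorem card_filter_coprime (n : ℕ) : #((range n).filter fun a => a.Coprime n) = n.totient := by
  rw [Nat.totient_eq_card_coprime]
  simp only [Nat.coprime_comm]

open MeasureTheory Finset in
/-- Overlaps of the balls around distinct reduced fractions, averaged over the scales. -/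
theorem sum_scales_overlap_le {B : Finset ℕ} (hB : ∀ n ∈ B, 0 < n) {T : ℕ} (hT : 2 ≤ T)
    (hBT : ∀ n ∈ B, 2 * Real.log n ≤ T) {δ : ℕ → ℝ} (hδ : ∀ n ∈ B, 0 ≤ δ n)
    (hδ1 : ∀ n ∈ B, 2 * δ n ≤ 1) (K : ℕ) :
    ∑ k ∈ Icc 1 K, Real.exp k ^ 2 * ∑ i ∈ reducedFractions B, ∑ j ∈ (reducedFractions B).erase i,
      (volume : Measure UnitAddCircle).real
        (Metric.ball (((i.2 : ℝ) / i.1 : ℝ) : UnitAddCircle) (Real.exp (-k) * δ i.1) ∩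
          Metric.ball (((j.2 : ℝ) / j.1 : ℝ) : UnitAddCircle) (Real.exp (-k) * δ j.1)) ≤
      288 * Real.exp 7 * (K + Real.log T) * (∑ n ∈ B, n.totient * δ n) ^ 2 := by
  have hexp : ∀ k : ℕ, Real.exp (-k) ≤ 1 := fun k => by
    rw [Real.exp_le_one_iff]; simp
  have hsc : ∀ (k : ℕ), ∀ n ∈ B, 2 * (Real.exp (-k) * δ n) ≤ 1 := fun k n hn => by
    have h1 := mul_le_mul_of_nonneg_right (hexp k) (hδ n hn)
    linarith [hδ1 n hn]
  have hpair : ∀ k : ℕ, ∑ i ∈ reducedFractions B, ∑ j ∈ (reducedFractions B).erase i,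
      (volume : Measure UnitAddCircle).real
        (Metric.ball (((i.2 : ℝ) / i.1 : ℝ) : UnitAddCircle) (Real.exp (-k) * δ i.1) ∩
          Metric.ball (((j.2 : ℝ) / j.1 : ℝ) : UnitAddCircle) (Real.exp (-k) * δ j.1)) ≤
      ∑ m ∈ B, ∑ n ∈ B, 2 * (Real.exp (-k) * min (δ m) (δ n)) *
        #(closePairs m n (Real.exp (-k) * (δ m + δ n))) := by
    intro k
    have h1 : ∀ i ∈ reducedFractions B, ∑ j ∈ (reducedFractions B).erase i,
      (volume : Measure UnitAddCircle).real
        (Metric.ball (((i.2 : ℝ) / i.1 : ℝ) : UnitAddCircle) (Real.exp (-k) * δ i.1) ∩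
          Metric.ball (((j.2 : ℝ) / j.1 : ℝ) : UnitAddCircle) (Real.exp (-k) * δ j.1)) ≤
      ∑ j ∈ reducedFractions B, 2 * (Real.exp (-k) * min (δ i.1) (δ j.1)) *
        if (i.1, i.2) ≠ (j.1, j.2) ∧
          ‖(((i.2 : ℝ) / i.1 - (j.2 : ℝ) / j.1 : ℝ) : UnitAddCircle)‖ <
            Real.exp (-k) * (δ i.1 + δ j.1) then 1 else 0 := by
      intro i hi
      have hi1 := (mem_sigma.1 hi).1
      refine (sum_le_sum fun j hj => ?_).trans (sum_le_sum_of_subset_of_nonneg (erase_subset _ _) ?_)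
      · obtain ⟨hji, hj⟩ := mem_erase.1 hj
        have hj1 := (mem_sigma.1 hj).1
        have hne : (i.1, i.2) ≠ (j.1, j.2) := by
          intro h
          obtain ⟨h1, h2⟩ := Prod.ext_iff.1 h
          exact hji (Sigma.ext h1.symm (heq_of_eq h2.symm))
        have h2 := volume_real_ball_inter_le (x := (((i.2 : ℝ) / i.1 : ℝ) : UnitAddCircle))
          (y := (((j.2 : ℝ) / j.1 : ℝ) : UnitAddCircle))
          (mul_nonneg (Real.exp_pos (-k)).le (hδ _ hi1))
          (mul_nonneg (Real.exp_pos (-k)).le (hδ _ hj1)) (hsc k _ hi1) (hsc k _ hj1)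
        rw [← mul_add, ← mul_min_of_nonneg _ _ (Real.exp_pos (-k)).le, ← AddCircle.coe_sub] at h2
        refine h2.trans (le_of_eq ?_)
        by_cases h3 : ‖(((i.2 : ℝ) / i.1 - (j.2 : ℝ) / j.1 : ℝ) : UnitAddCircle)‖ <
            Real.exp (-k) * (δ i.1 + δ j.1)
        · rw [if_pos h3, if_pos ⟨hne, h3⟩, mul_one]
        · rw [if_neg h3, if_neg fun h => h3 h.2, mul_zero]
      · intro j hj _
        have h2 : 0 ≤ min (δ i.1) (δ j.1) := le_min (hδ _ hi1) (hδ _ (mem_sigma.1 hj).1)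
        split_ifs <;> positivity
    refine (sum_le_sum h1).trans (le_of_eq ?_)
    simp only [reducedFractions, sum_sigma]
    refine sum_congr rfl fun m hm => ?_
    rw [sum_comm]
    refine sum_congr rfl fun n hn => ?_
    rw [← sum_product', ← mul_sum, closePairs, sum_boole]
    congr 3
    ext x
    simp only [mem_filter, mem_product, mem_range]
    tauto
  calc _ ≤ ∑ k ∈ Icc 1 K, Real.exp k ^ 2 * ∑ m ∈ B, ∑ n ∈ B,
        2 * (Real.exp (-k) * min (δ m) (δ n)) *
          #(closePairs m n (Real.exp (-k) * (δ m + δ n))) :=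
        sum_le_sum fun k _ => mul_le_mul_of_nonneg_left (hpair k) (by positivity)
    -- One `exp k` cancels the factor `exp (-k)` in the measure of an overlap; the other is the
    -- weight needed for the count of close pairs.
    _ = ∑ m ∈ B, ∑ n ∈ B, 2 * min (δ m) (δ n) * ∑ k ∈ Icc 1 K, Real.exp k *
          #(closePairs m n (Real.exp (-k) * (δ m + δ n))) := by
        simp_rw [mul_sum]
        rw [sum_comm]
        refine sum_congr rfl fun m _ => ?_
        rw [sum_comm]
        refine sum_congr rfl fun n _ => sum_congr rfl fun k _ => ?_
        have h1 : Real.exp k * Real.exp (-k) = 1 := by rw [← Real.exp_add]; simp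
        linear_combination (2 * Real.exp k * min (δ m) (δ n) *
          #(closePairs m n (Real.exp (-k) * (δ m + δ n)))) * h1
    _ ≤ ∑ m ∈ B, ∑ n ∈ B, 2 * min (δ m) (δ n) *
          (72 * Real.exp 7 * (K + Real.log T) * (m.totient * n.totient * (δ m + δ n))) := by
        refine sum_le_sum fun m hm => sum_le_sum fun n hn => ?_
        have h1 : 0 ≤ min (δ m) (δ n) := le_min (hδ _ hm) (hδ _ hn)
        refine mul_le_mul_of_nonneg_left ?_ (by positivity)
        refine sum_scales_card_closePairs_le (hB m hm) (hB n hn) hT ?_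
          (add_nonneg (hδ _ hm) (hδ _ hn)) K
        have hm0 : (m : ℝ) ≠ 0 := by exact_mod_cast (hB m hm).ne'
        have hn0 : (n : ℝ) ≠ 0 := by exact_mod_cast (hB n hn).ne'
        rw [Nat.cast_mul, Real.log_mul hm0 hn0]
        linarith [hBT m hm, hBT n hn]
    _ ≤ ∑ m ∈ B, ∑ n ∈ B, 288 * Real.exp 7 * (K + Real.log T) *
          ((m.totient * δ m) * (n.totient * δ n)) := by
        refine sum_le_sum fun m hm => sum_le_sum fun n hn => ?_
        -- The sum is at most twice the maximum, and minimum times maximum is the product.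
        have h1 : min (δ m) (δ n) * (δ m + δ n) ≤ 2 * (δ m * δ n) := by
          have hm0 := hδ m hm
          have hn0 := hδ n hn
          rcases le_total (δ m) (δ n) with h | h
          · rw [min_eq_left h]; nlinarith
          · rw [min_eq_right h]; nlinarith
        have hL : 0 ≤ Real.log T := Real.log_natCast_nonneg T
        have h2 : 0 ≤ 144 * Real.exp 7 * (K + Real.log T) * (m.totient * n.totient) := by positivity
        have h3 := mul_le_mul_of_nonneg_left h1 h2
        linarith
    _ = _ := by
        rw [sq, sum_mul_sum]
        simp_rw [mul_sum]

theorem inv_le_of_sq_le {M O C v : ℝ} (hM : 1 ≤ M) (hC : 0 ≤ C) (hv : 0 ≤ v)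
    (hO : O ≤ C * M ^ 2) (h : M ^ 2 ≤ v * (M + O)) : (1 + C)⁻¹ ≤ v := by
  rw [inv_le_iff_one_le_mul₀ (by positivity)]
  have h5 : M + O ≤ (1 + C) * M ^ 2 := by nlinarith
  have h6 : M ^ 2 ≤ v * ((1 + C) * M ^ 2) := h.trans (mul_le_mul_of_nonneg_left h5 hv)
  have h7 : 0 < M ^ 2 := by positivity
  refine le_of_mul_le_mul_right (a := M ^ 2) ?_ h7
  linarith

-- Shrinking the radii by `exp (-k)` only shrinks the union, and for `k ≤ K` the total measure `M =
-- 2 exp (-k) S` stays at least 1. By pigeonhole over the `K` scales, some `k` has overlaps at most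
-- `72 exp 7 (1 + log T / K) M ^ 2` (`288 / 4 = 72`), and Chung–Erdős applies.
open MeasureTheory Finset in
theorem volume_real_iUnion_ball_ge {B : Finset ℕ} (hB : ∀ n ∈ B, 0 < n) {T : ℕ} (hT : 2 ≤ T)
    (hBT : ∀ n ∈ B, 2 * Real.log n ≤ T) {δ : ℕ → ℝ} (hδ : ∀ n ∈ B, 0 ≤ δ n)
    (hδ1 : ∀ n ∈ B, 2 * δ n ≤ 1) {K : ℕ} (hK : 1 ≤ K)
    (hS : Real.exp K ≤ ∑ n ∈ B, n.totient * δ n) :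
    (1 + 72 * Real.exp 7 * (1 + Real.log T / K))⁻¹ ≤
      (volume : Measure UnitAddCircle).real (⋃ i ∈ reducedFractions B,
        Metric.ball (((i.2 : ℝ) / i.1 : ℝ) : UnitAddCircle) (δ i.1)) := by
  set μ : Measure UnitAddCircle := volume with hμ
  set S := ∑ n ∈ B, n.totient * δ n with hSdef
  set I := reducedFractions B with hI
  set b : ℕ → (Σ _ : ℕ, ℕ) → Set UnitAddCircle := fun k i =>
    Metric.ball (((i.2 : ℝ) / i.1 : ℝ) : UnitAddCircle) (Real.exp (-k) * δ i.1) with hb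
  have hL : 0 ≤ Real.log T := Real.log_natCast_nonneg T
  have hK0 : (0 : ℝ) < K := by exact_mod_cast hK
  have h1 : ∑ k ∈ Icc 1 K, Real.exp k ^ 2 * ∑ i ∈ I, ∑ j ∈ I.erase i, μ.real (b k i ∩ b k j) ≤
      288 * Real.exp 7 * (K + Real.log T) * S ^ 2 := sum_scales_overlap_le hB hT hBT hδ hδ1 K
  have h2 : 288 * Real.exp 7 * (K + Real.log T) * S ^ 2 =
      ∑ _k ∈ Icc 1 K, 288 * Real.exp 7 * (1 + Real.log T / K) * S ^ 2 := by
    rw [sum_const, Nat.card_Icc, nsmul_eq_mul, Nat.add_sub_cancel]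
    field_simp
  rw [h2] at h1
  obtain ⟨k, hk, hk1⟩ := exists_le_of_sum_le (nonempty_Icc.2 hK) h1
  have hexp : Real.exp (-k) ≤ 1 := by rw [Real.exp_le_one_iff]; simp
  have hee : Real.exp k * Real.exp (-k) = 1 := by rw [← Real.exp_add]; simp
  set M := ∑ i ∈ I, μ.real (b k i) with hM
  set O := ∑ i ∈ I, ∑ j ∈ I.erase i, μ.real (b k i ∩ b k j) with hO
  have hMS : M = 2 * Real.exp (-k) * S := by
    rw [hM, hI, reducedFractions, sum_sigma, hSdef, mul_sum]
    refine sum_congr rfl fun n hn => ?_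
    have h3 : ∀ a ∈ (range n).filter fun a => a.Coprime n,
        μ.real (b k ⟨n, a⟩) = 2 * (Real.exp (-k) * δ n) := fun a _ => by
      refine volume_real_ball (mul_nonneg (Real.exp_pos _).le (hδ n hn)) ?_
      have h4 := mul_le_mul_of_nonneg_right hexp (hδ n hn)
      linarith [hδ1 n hn]
    rw [sum_congr rfl h3, sum_const, card_filter_coprime, nsmul_eq_mul]
    ring
  have hM1 : 1 ≤ M := by
    rw [hMS]
    have h4 : Real.exp k ≤ S := by
      refine le_trans (Real.exp_le_exp.2 ?_) hS
      exact_mod_cast (mem_Icc.1 hk).2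
    have h5 := mul_le_mul_of_nonneg_left h4 (Real.exp_pos (-k)).le
    nlinarith
  have hO1 : O ≤ 72 * Real.exp 7 * (1 + Real.log T / K) * M ^ 2 := by
    have h3 : Real.exp (-k) ^ 2 * (Real.exp k ^ 2 * O) ≤
        Real.exp (-k) ^ 2 * (288 * Real.exp 7 * (1 + Real.log T / K) * S ^ 2) :=
      mul_le_mul_of_nonneg_left hk1 (by positivity)
    have h4 : Real.exp (-k) ^ 2 * (Real.exp k ^ 2 * O) = O := by
      rw [← mul_assoc, ← mul_pow, mul_comm (Real.exp (-k)), hee, one_pow, one_mul]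
    rw [h4] at h3
    rw [hMS]
    linarith
  have hCE := sq_sum_measureReal_le μ I (b k) fun i _ => Metric.isOpen_ball.measurableSet
  have hsplit : ∑ i ∈ I, ∑ j ∈ I, μ.real (b k i ∩ b k j) = M + O := by
    rw [hM, hO, ← sum_add_distrib]
    refine sum_congr rfl fun i hi => ?_
    rw [← add_sum_erase I _ hi, Set.inter_self]
  rw [hsplit] at hCE
  change M ^ 2 ≤ _ at hCE
  have hsub : μ.real (⋃ i ∈ I, b k i) ≤ μ.real (⋃ i ∈ I,
        Metric.ball (((i.2 : ℝ) / i.1 : ℝ) : UnitAddCircle) (δ i.1)) := by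
    refine measureReal_mono (Set.iUnion₂_mono fun i hi => Metric.ball_subset_ball ?_)
      (measure_ne_top _ _)
    exact mul_le_of_le_one_left (hδ _ (mem_sigma.1 hi).1) hexp
  refine le_trans ?_ hsub
  have hC0 : 0 ≤ 72 * Real.exp 7 * (1 + Real.log T / K) := by positivity
  exact inv_le_of_sq_le hM1 hC0 measureReal_nonneg hO1 hCE

/-! ### Blocks of denominators and the use of the extra divergence -/

theorem one_le_logOne (x : ℝ) : 1 ≤ logOne x := le_max_left _ _

theorem logOne_pos (x : ℝ) : 0 < logOne x := zero_lt_one.trans_le (one_le_logOne x)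

theorem log_le_logOne (x : ℝ) : Real.log x ≤ logOne x := le_max_right _ _

-- The term `c = 1` alone makes the sum in `sum_inv_totient_le` at least 1. With `T` of size `log n`
-- and the wasteful `log T ≤ T` this is crude, but any power of `log n` suffices for the truncation.
open Finset in
theorem inv_logOne_le_totientRatio {n : ℕ} (hn : n ≠ 0) :
    (12 * Real.exp 7 * logOne n)⁻¹ ≤ totientRatio n := by
  set T : ℕ := ⌈Real.log n⌉₊ + 2 with hT
  have hlog : 0 ≤ Real.log n := Real.log_natCast_nonneg n
  have h1 : Real.log n ≤ T := by
    rw [hT]; push_cast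
    linarith [Nat.le_ceil (Real.log n)]
  have h2 : (T : ℝ) ≤ 4 * logOne n := by
    rw [hT]; push_cast
    linarith [Nat.ceil_lt_add_one hlog, one_le_logOne n, log_le_logOne n]
  have h3 := sum_inv_totient_le hn (n := T) (by omega) h1
  have h4 : (1 : ℝ) ≤ ∑ c ∈ Ioc 0 T with c.Coprime n, ((c.totient : ℝ))⁻¹ := by
    have h5 : (1 : ℕ) ∈ (Ioc 0 T).filter fun c => c.Coprime n := by simp [hT]
    have h6 := single_le_sum (f := fun c : ℕ => ((c.totient : ℝ))⁻¹)
      (fun c _ => by positivity) h5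
    simpa using h6
  have hT0 : (0 : ℝ) < T := by rw [hT]; positivity
  have h5 : Real.log T ≤ 4 * logOne n := (Real.log_le_self hT0.le).trans h2
  have hr := totientRatio_pos hn
  have hl := logOne_pos n
  rw [inv_le_iff_one_le_mul₀ (by positivity)]
  calc (1 : ℝ) ≤ 3 * Real.exp 7 * Real.log T * totientRatio n := h4.trans h3
    _ ≤ 3 * Real.exp 7 * (4 * logOne n) * totientRatio n := by gcongr
    _ = _ := by ring

open Filter Topology in
theorem eventually_one_le_sqrt_term (ε : ℝ) :
    ∀ᶠ n : ℕ in atTop,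
      1 ≤ √(n : ℝ) / 2 * (n.totient : ℝ) / ((n : ℝ) * logOne (n : ℝ) ^ ε) := by
  have h1 := (isLittleO_log_rpow_rpow_atTop (1 + ε) (by norm_num : (0 : ℝ) < 1 / 2)).def
    (by positivity : 0 < (24 * Real.exp 7)⁻¹)
  have h2 := tendsto_natCast_atTop_atTop (R := ℝ) |>.eventually h1
  filter_upwards [h2, eventually_ge_atTop 3] with n hn hn3
  have hn3' : (3 : ℝ) ≤ n := by exact_mod_cast hn3
  have hn0 : n ≠ 0 := by omega
  have hlog : 1 ≤ Real.log n := by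
    rw [Real.le_log_iff_exp_le (by linarith)]
    linarith [Real.exp_one_lt_d9]
  have hlo : logOne n = Real.log n := max_eq_right hlog
  have hr := inv_logOne_le_totientRatio hn0
  rw [Real.norm_of_nonneg (by positivity), Real.norm_of_nonneg (by positivity),
    ← Real.sqrt_eq_rpow, Real.rpow_add (by linarith), Real.rpow_one, ← hlo] at hn
  have hl := logOne_pos n
  have hle : 0 < logOne n ^ ε := Real.rpow_pos_of_pos hl ε
  have h3 : √(n : ℝ) / 2 * (n.totient : ℝ) / ((n : ℝ) * logOne (n : ℝ) ^ ε) =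
      √(n : ℝ) / 2 * totientRatio n / logOne n ^ ε := by
    rw [totientRatio]; field_simp
  rw [h3, le_div_iff₀ hle, one_mul]
  have h4 : √(n : ℝ) / 2 * (12 * Real.exp 7 * logOne n)⁻¹ ≤ √(n : ℝ) / 2 * totientRatio n := by
    gcongr
  refine le_trans ?_ h4
  rw [← div_eq_mul_inv, le_div_iff₀ (by positivity)]
  rw [inv_mul_eq_div, le_div_iff₀ (by positivity)] at hn
  linarith

/-- The index of the range `exp j ≤ logOne n < exp (j + 1)` which contains `n`. -/
noncomputable def blockIndex (n : ℕ) : ℕ := ⌊Real.log (logOne n)⌋₊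

theorem log_logOne_nonneg (x : ℝ) : 0 ≤ Real.log (logOne x) := Real.log_nonneg (one_le_logOne x)

theorem exp_blockIndex_le (n : ℕ) : Real.exp (blockIndex n) ≤ logOne n := by
  rw [← Real.le_log_iff_exp_le (logOne_pos _)]
  exact Nat.floor_le (log_logOne_nonneg _)

theorem logOne_lt_exp_blockIndex (n : ℕ) : logOne n < Real.exp (blockIndex n + 1) := by
  rw [← Real.log_lt_iff_lt_exp (logOne_pos _)]
  exact Nat.lt_floor_add_one _

/-- The positive integers of block index `j`. -/
noncomputable def block (j : ℕ) : Finset ℕ :=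
  {n ∈ Finset.Ioc 0 ⌊Real.exp (Real.exp (j + 1))⌋₊ | blockIndex n = j}

theorem mem_block {n j : ℕ} : n ∈ block j ↔ 0 < n ∧ blockIndex n = j := by
  simp only [block, Finset.mem_filter, Finset.mem_Ioc]
  constructor
  · rintro ⟨⟨h1, -⟩, h2⟩
    exact ⟨h1, h2⟩
  · rintro ⟨h1, rfl⟩
    refine ⟨⟨h1, Nat.le_floor ?_⟩, rfl⟩
    rw [← Real.log_le_iff_le_exp (by exact_mod_cast h1)]
    exact (log_le_logOne _).trans (logOne_lt_exp_blockIndex n).le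

-- On block `j` the weight `logOne n ^ ε` is at least `exp (ε j)`. If the block sums were eventually
-- below `exp (ε j / 2)`, the series would be dominated by a geometric one.
open Filter Finset in
theorem frequently_block_sum_ge {ψ : ℕ → ℝ} (hψ : ∀ n, 0 ≤ ψ n) {ε : ℝ} (hε : 0 < ε)
    (h : ¬ Summable fun n : ℕ => ψ n * (n.totient : ℝ) / ((n : ℝ) * logOne (n : ℝ) ^ ε)) :
    ∃ᶠ j : ℕ in atTop, Real.exp (ε * j / 2) ≤ ∑ n ∈ block j, n.totient * (ψ n / n) := by
  by_contra hcon
  rw [not_frequently] at hcon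
  refine h ?_
  set a : ℕ → ℝ := fun n => ψ n * (n.totient : ℝ) / ((n : ℝ) * logOne (n : ℝ) ^ ε) with ha
  have ha0 : ∀ n, 0 ≤ a n := fun n => by
    have h1 := hψ n
    have h2 := logOne_pos n
    positivity
  have hblock : ∀ j, ∑ n ∈ block j, a n ≤
      Real.exp (-(ε * j)) * ∑ n ∈ block j, n.totient * (ψ n / n) := by
    intro j
    rw [mul_sum]
    refine sum_le_sum fun n hn => ?_
    obtain ⟨h1, rfl⟩ := mem_block.1 hn
    have h2 : Real.exp (ε * blockIndex n) ≤ logOne n ^ ε := by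
      rw [mul_comm, Real.exp_mul]
      exact Real.rpow_le_rpow (Real.exp_pos _).le (exp_blockIndex_le n) hε.le
    have h3 : a n = n.totient * (ψ n / n) / logOne n ^ ε := by
      simp only [ha]; rw [div_mul_eq_div_div]; ring
    rw [h3, Real.exp_neg, inv_mul_eq_div]
    have h4 := hψ n
    gcongr
  have hsum : Summable fun j : ℕ => ∑ n ∈ block j, a n := by
    have hgeo : Summable fun j : ℕ => Real.exp (-(ε / 2)) ^ j :=
      summable_geometric_of_lt_one (Real.exp_pos _).le (by rw [Real.exp_lt_one_iff]; linarith)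
    refine summable_of_isBigO_nat hgeo (Asymptotics.IsBigO.of_bound 1 ?_)
    filter_upwards [hcon] with j hj
    rw [Real.norm_of_nonneg (sum_nonneg fun n _ => ha0 n), Real.norm_of_nonneg (by positivity),
      one_mul, ← Real.exp_nat_mul]
    refine (hblock j).trans ?_
    calc _ ≤ Real.exp (-(ε * j)) * Real.exp (ε * j / 2) :=
          mul_le_mul_of_nonneg_left (not_le.1 hj).le (Real.exp_pos _).le
      _ = _ := by rw [← Real.exp_add]; congr 1; ring
  refine summable_of_sum_le (c := ∑' j, ∑ n ∈ block j, a n) ha0 fun u => ?_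
  -- The index 0 belongs to no block, so its term has to vanish.
  have ha_zero : a 0 = 0 := by simp [ha]
  rw [← sum_erase u ha_zero, ← sum_fiberwise_of_maps_to
    (t := (u.erase 0).image blockIndex) (g := blockIndex) fun n hn => mem_image_of_mem _ hn]
  refine le_trans (sum_le_sum fun j _ => ?_)
    (hsum.sum_le_tsum _ fun j _ => sum_nonneg fun n _ => ha0 n)
  refine sum_le_sum_of_subset_of_nonneg (fun n hn => ?_) fun n _ _ => ha0 n
  rw [mem_filter, mem_erase] at hn
  exact mem_block.2 ⟨Nat.pos_of_ne_zero hn.1.1, hn.2⟩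

-- Here `T` bounds `2 log n` on the block, so `log T ≤ 4 j`, while the size of `S` permits `K ≥ ε j
-- / 4`. Hence `log T / K ≤ 16 / ε` uniformly in `j`.
open MeasureTheory Filter Finset in
theorem frequently_volume_block_ge {ψ : ℕ → ℝ} (hψ : ∀ n, 0 ≤ ψ n)
    (hψ1 : ∀ n : ℕ, 2 * (ψ n / n) ≤ 1) {ε : ℝ} (hε : 0 < ε)
    (h : ¬ Summable fun n : ℕ => ψ n * (n.totient : ℝ) / ((n : ℝ) * logOne (n : ℝ) ^ ε)) :
    ∃ᶠ j : ℕ in atTop, (1 + 72 * Real.exp 7 * (1 + 16 / ε))⁻¹ ≤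
      (volume : Measure UnitAddCircle).real (⋃ i ∈ reducedFractions (block j),
        Metric.ball (((i.2 : ℝ) / i.1 : ℝ) : UnitAddCircle) (ψ i.1 / i.1)) := by
  -- For `ε j ≥ 4` the floor of `ε j / 2` is at least `ε j / 4`, hence at least 1.
  have hlarge : ∀ᶠ j : ℕ in atTop, 4 / ε ≤ j ∧ 1 ≤ j :=
    (tendsto_natCast_atTop_atTop.eventually_ge_atTop (4 / ε)).and (eventually_ge_atTop 1)
  refine ((frequently_block_sum_ge hψ hε h).and_eventually hlarge).mono ?_
  rintro j ⟨hj, hj4, hj1⟩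
  have hj1' : (1 : ℝ) ≤ j := by exact_mod_cast hj1
  rw [div_le_iff₀ hε] at hj4
  set K : ℕ := ⌊ε * j / 2⌋₊ with hK
  set T : ℕ := ⌈2 * Real.exp (j + 1)⌉₊ with hT
  have hKle : (K : ℝ) ≤ ε * j / 2 := Nat.floor_le (by positivity)
  have hKge : ε * j / 4 ≤ K := by
    have := Nat.lt_floor_add_one (ε * j / 2)
    rw [← hK] at this
    linarith
  have hK1 : 1 ≤ K := by
    have : (1 : ℝ) ≤ K := by linarith
    exact_mod_cast this
  have hexp1 : (1 : ℝ) ≤ Real.exp (j + 1) := Real.one_le_exp (by positivity)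
  have hTge : 2 * Real.exp (j + 1) ≤ T := Nat.le_ceil _
  have hT2 : 2 ≤ T := by
    have : (2 : ℝ) ≤ T := by linarith
    exact_mod_cast this
  have hTlog : Real.log T ≤ 4 * j := by
    have h1 : (T : ℝ) ≤ Real.exp (j + 3) := by
      have h2 := Nat.ceil_lt_add_one (by positivity : 0 ≤ 2 * Real.exp ((j : ℝ) + 1))
      rw [← hT] at h2
      have h3 : Real.exp ((j : ℝ) + 3) = Real.exp (j + 1) * Real.exp 2 := by
        rw [← Real.exp_add]; congr 1; ring
      have h4 : (3 : ℝ) ≤ Real.exp 2 := by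
        have := Real.add_one_le_exp (2 : ℝ); linarith
      rw [h3]
      nlinarith
    have h2 : Real.log T ≤ j + 3 := by
      rw [Real.log_le_iff_le_exp (by exact_mod_cast by omega)]
      exact h1
    linarith
  have hmain := volume_real_iUnion_ball_ge (B := block j) (fun n hn => (mem_block.1 hn).1) hT2
    (fun n hn => by
      obtain ⟨h1, rfl⟩ := mem_block.1 hn
      have h2 := (log_le_logOne n).trans (logOne_lt_exp_blockIndex n).le
      linarith) (δ := fun n => ψ n / n) (fun n _ => div_nonneg (hψ n) (by positivity))
    (fun n _ => hψ1 n) hK1 ((Real.exp_le_exp.2 hKle).trans hj)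
  refine le_trans ?_ hmain
  have hK0 : (0 : ℝ) < K := by exact_mod_cast hK1
  have hTK : Real.log T / K ≤ 16 / ε := by
    rw [div_le_div_iff₀ hK0 hε]
    have := mul_le_mul_of_nonneg_left hTlog hε.le
    linarith
  have hL : 0 ≤ Real.log T := Real.log_natCast_nonneg T
  gcongr

/-! ### Full measure on the circle by the zero-one law -/

-- Continuity from above along the decreasing tail unions, each of which contains some `U j` of
-- measure at least `c`.
open MeasureTheory Filter in
theorem le_measure_setOf_frequently {Ω : Type*} [MeasurableSpace Ω] (μ : Measure Ω)
    [IsFiniteMeasure μ] {U : ℕ → Set Ω} (hU : ∀ j, MeasurableSet (U j)) {c : ENNReal}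
    (h : ∃ᶠ j in atTop, c ≤ μ (U j)) : c ≤ μ {x | ∃ᶠ j in atTop, x ∈ U j} := by
  have h1 : {x | ∃ᶠ j in atTop, x ∈ U j} = ⋂ J : ℕ, ⋃ j ≥ J, U j := by
    ext x
    simp [frequently_atTop]
  have h2 : Antitone fun J : ℕ => ⋃ j ≥ J, U j := fun J J' hJ =>
    Set.biUnion_subset_biUnion_left fun j (hj : J' ≤ j) => hJ.trans hj
  have h3 := tendsto_measure_iInter_atTop (μ := μ) (s := fun J : ℕ => ⋃ j ≥ J, U j)
    (fun J => (MeasurableSet.biUnion (Set.to_countable _) fun j _ => hU j).nullMeasurableSet) h2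
    ⟨0, measure_ne_top _ _⟩
  rw [h1]
  refine ge_of_tendsto' h3 fun J => ?_
  obtain ⟨j, hj, hcj⟩ := frequently_atTop.1 h J
  exact hcj.trans (measure_mono (Set.subset_iUnion₂ (s := fun j (_ : j ≥ J) => U j) j hj))

open MeasureTheory Filter Topology in
theorem ae_mem_addWellApproximable {ψ : ℕ → ℝ} (hψ : ∀ n, 0 ≤ ψ n)
    (hψ1 : ∀ n : ℕ, 2 * (ψ n / n) ≤ 1) (hψ0 : Tendsto (fun n : ℕ => ψ n / n) atTop (𝓝 0))
    {ε : ℝ} (hε : 0 < ε)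
    (h : ¬ Summable fun n : ℕ => ψ n * (n.totient : ℝ) / ((n : ℝ) * logOne (n : ℝ) ^ ε)) :
    ∀ᵐ x : UnitAddCircle, x ∈ addWellApproximable UnitAddCircle fun n => ψ n / n := by
  refine (AddCircle.addWellApproximable_ae_empty_or_univ (T := 1) (fun n => ψ n / n) hψ0).resolve_left
    fun hae => ?_
  set U : ℕ → Set UnitAddCircle := fun j => ⋃ i ∈ reducedFractions (block j),
    Metric.ball (((i.2 : ℝ) / i.1 : ℝ) : UnitAddCircle) (ψ i.1 / i.1) with hU
  have hsub : {x | ∃ᶠ j in atTop, x ∈ U j} ⊆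
      addWellApproximable UnitAddCircle fun n => ψ n / n := by
    intro x hx
    rw [UnitAddCircle.mem_addWellApproximable_iff]
    have hx' : {j | x ∈ U j}.Infinite := Nat.frequently_atTop_iff_infinite.1 hx
    -- Each `n` has only one block index, so infinitely many blocks yield infinitely many `n`.
    refine Set.Infinite.of_image blockIndex (hx'.mono fun j hj => ?_)
    simp only [hU, Set.mem_ofPred_eq, Set.mem_iUnion, exists_prop] at hj
    obtain ⟨⟨n, a⟩, hi, hball⟩ := hj
    obtain ⟨hn, ha⟩ := Finset.mem_sigma.1 hi
    simp only [Finset.mem_filter, Finset.mem_range] at ha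
    refine ⟨n, ⟨a, ha.1, ha.2, ?_⟩, (mem_block.1 hn).2⟩
    rw [Metric.mem_ball, dist_eq_norm] at hball
    exact hball
  have hc : (0 : ℝ) < (1 + 72 * Real.exp 7 * (1 + 16 / ε))⁻¹ := by positivity
  have h1 : ∃ᶠ j in atTop, ENNReal.ofReal (1 + 72 * Real.exp 7 * (1 + 16 / ε))⁻¹ ≤
      (volume : Measure UnitAddCircle) (U j) := by
    refine (frequently_volume_block_ge hψ hψ1 hε h).mono fun j hj => ?_
    rw [ENNReal.ofReal_le_iff_le_toReal (measure_ne_top _ _)]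
    exact hj
  have h2 := le_measure_setOf_frequently (volume : Measure UnitAddCircle) (U := U)
    (fun j => Finset.measurableSet_biUnion _ fun i _ => Metric.isOpen_ball.measurableSet) h1
  have h3 : (volume : Measure UnitAddCircle)
      (addWellApproximable UnitAddCircle fun n => ψ n / n) = 0 := by
    exact measure_eq_zero_iff_ae_notMem.2 hae
  have h4 := (h2.trans (measure_mono hsub)).trans_eq h3
  rw [nonpos_iff_eq_zero, ENNReal.ofReal_eq_zero] at h4
  linarith

/-! ### From the circle to the real line, and truncation -/

open MeasureTheory in
theorem ae_coe_of_ae_unitAddCircle {p : UnitAddCircle → Prop}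
    (h : ∀ᵐ x : UnitAddCircle, p x) : ∀ᵐ y : ℝ, p (y : UnitAddCircle) := by
  have h1 : ∀ z : ℤ, ∀ᵐ y : ℝ ∂(volume.restrict (Set.Ioc ((0 : ℝ) + z) (0 + z + 1))),
      p (y : UnitAddCircle) := fun z =>
    (UnitAddCircle.measurePreserving_mk _).quasiMeasurePreserving.ae h
  rw [← Measure.restrict_univ (μ := (volume : Measure ℝ)), ← iUnion_Ioc_add_intCast (0 : ℝ),
    ae_restrict_iUnion_iff]
  exact h1

theorem exists_int_of_norm_lt {y ψ δ : ℝ} {m n : ℕ} (hn : 0 < n) (hδ : δ ≤ ψ)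
    (h : ‖(y : UnitAddCircle) - (((m : ℝ) / n : ℝ) : UnitAddCircle)‖ < δ / n) :
    ∃ z : ℤ, |(n : ℝ) * (y - z) - m| < ψ := by
  rw [← AddCircle.coe_sub, UnitAddCircle.norm_eq] at h
  refine ⟨round (y - (m : ℝ) / n), ?_⟩
  have hn0 : (0 : ℝ) < n := by exact_mod_cast hn
  have h1 : (n : ℝ) * (y - round (y - (m : ℝ) / n)) - m =
      n * (y - (m : ℝ) / n - round (y - (m : ℝ) / n)) := by
    generalize round (y - (m : ℝ) / n) = z
    field_simp
    ring
  rw [h1, abs_mul, Nat.abs_cast]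
  rw [lt_div_iff₀ hn0] at h
  linarith

theorem mem_approxSet_of_norm_lt {ψ : ℕ → ℝ} {y δ : ℝ} {m n : ℕ} (hmn : m < n)
    (hcop : m.gcd n = 1) (hδ : δ ≤ ψ n)
    (h : ‖(y : UnitAddCircle) - (((m : ℝ) / n : ℝ) : UnitAddCircle)‖ < δ / n) :
    (y : UnitAddCircle) ∈ approxSet ψ n := by
  have hn : 0 < n := by omega
  have hn0 : (0 : ℝ) < n := by exact_mod_cast hn
  obtain ⟨z, hz⟩ := exists_int_of_norm_lt hn hδ h
  rw [abs_lt] at hz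
  simp only [approxSet, Set.mem_iUnion, exists_prop]
  -- Numerators in `approxSet` start at 1. The residue `m = 0` is reduced only for `n = 1`, where `a
  -- = 1` replaces it after a shift by one.
  rcases Nat.eq_zero_or_pos m with rfl | hm
  · rw [Nat.gcd_zero_left] at hcop
    subst hcop
    refine ⟨1, ⟨le_rfl, le_rfl, Nat.coprime_one_left 1⟩, y - z + 1, ⟨?_, ?_⟩, ?_⟩
    · push_cast at hz ⊢; linarith
    · push_cast at hz ⊢; linarith
    · have h1 : (y - z + 1 : ℝ) = y - ((z - 1 : ℤ) : ℝ) := by push_cast; ring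
      have h2 : (((z - 1 : ℤ) : ℝ) : UnitAddCircle) = 0 := by
        rw [AddCircle.coe_eq_zero_iff]; exact ⟨z - 1, by simp⟩
      simp only [h1, AddCircle.coe_sub, h2, sub_zero]
  · refine ⟨m, ⟨hm, hmn.le, hcop⟩, y - z, ⟨?_, ?_⟩, ?_⟩
    · rw [div_lt_iff₀ hn0]; linarith
    · rw [lt_div_iff₀ hn0]; linarith
    · have h2 : ((z : ℝ) : UnitAddCircle) = 0 := by
        rw [AddCircle.coe_eq_zero_iff]; exact ⟨z, by simp⟩
      simp only [AddCircle.coe_sub, h2, sub_zero]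

theorem exists_mem_coprimeSolutions_of_norm_lt {ψ : ℕ → ℝ} {y δ : ℝ} {m n : ℕ} (hmn : m < n)
    (hcop : m.gcd n = 1) (hδ : δ ≤ ψ n)
    (h : ‖(y : UnitAddCircle) - (((m : ℝ) / n : ℝ) : UnitAddCircle)‖ < δ / n) :
    ∃ a : ℤ, (a, n) ∈ coprimeSolutions ψ y := by
  have hn : 0 < n := by omega
  obtain ⟨z, hz⟩ := exists_int_of_norm_lt hn hδ h
  refine ⟨m + z * n, hn, ?_, ?_⟩
  · exact IsCoprime.add_mul_right_left (Nat.isCoprime_iff_coprime.2 hcop) z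
  · simp only
    push_cast
    rwa [show (n : ℝ) * y - (m + z * n) = n * (y - z) - m by ring]

open Filter Topology in
theorem tendsto_min_sqrt_div {ψ : ℕ → ℝ} (hψ : ∀ n, 0 ≤ ψ n) :
    Tendsto (fun n : ℕ => min (ψ n) (√(n : ℝ) / 2) / n) atTop (𝓝 0) := by
  have h1 : Tendsto (fun n : ℕ => (√(n : ℝ))⁻¹) atTop (𝓝 0) :=
    (Real.tendsto_sqrt_atTop.comp tendsto_natCast_atTop_atTop).inv_tendsto_atTop
  refine squeeze_zero (fun n => div_nonneg (le_min (hψ n) (by positivity)) (by positivity))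
    (fun n => ?_) h1
  rcases Nat.eq_zero_or_pos n with rfl | hn
  · simp
  have hn0 : (0 : ℝ) < n := by exact_mod_cast hn
  have hs : 0 < √(n : ℝ) := Real.sqrt_pos.2 hn0
  rw [div_le_iff₀ hn0]
  have h2 : (√(n : ℝ))⁻¹ * n = √(n : ℝ) := by
    rw [inv_mul_eq_div, div_eq_iff hs.ne', Real.mul_self_sqrt hn0.le]
  rw [h2]
  exact (min_le_right _ _).trans (by linarith)

theorem two_mul_min_sqrt_div_le (x : ℝ) (n : ℕ) : 2 * (min x (√(n : ℝ) / 2) / n) ≤ 1 := by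
  rcases Nat.eq_zero_or_pos n with rfl | hn
  · simp
  have hn1 : (1 : ℝ) ≤ n := by exact_mod_cast hn
  have h1 : √(n : ℝ) ≤ n := Real.sqrt_le_iff.2 ⟨by linarith, by nlinarith⟩
  rw [← mul_div_assoc, div_le_one (by linarith)]
  linarith [min_le_right x (√(n : ℝ) / 2)]

-- If the truncated series converged, its terms would eventually be below 1, whereas the terms with
-- `√n / 2` are eventually at least 1. So the minimum would be `ψ n` for all large `n`, and the
-- original series would converge.
open Filter Topology in
theorem not_summable_min_sqrt {ψ : ℕ → ℝ} {ε : ℝ}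
    (h : ¬ Summable fun n : ℕ => ψ n * (n.totient : ℝ) / ((n : ℝ) * logOne (n : ℝ) ^ ε)) :
    ¬ Summable fun n : ℕ => min (ψ n) (√(n : ℝ) / 2) * (n.totient : ℝ) /
      ((n : ℝ) * logOne (n : ℝ) ^ ε) := by
  refine fun hs => h (hs.congr_atTop ?_)
  filter_upwards [hs.tendsto_atTop_zero.eventually_lt_const one_pos,
    eventually_one_le_sqrt_term ε] with n h1 h2
  rcases min_choice (ψ n) (√(n : ℝ) / 2) with h3 | h3
  · rw [h3]
  · rw [h3] at h1
    linarith

open Filter Finset in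
theorem not_summable_of_tendsto_sum_Icc {f : ℕ → ℝ} (hf : ∀ n, 0 ≤ f n)
    (h : Tendsto (fun N : ℕ => ∑ n ∈ Icc 1 N, f n) atTop atTop) : ¬ Summable f := by
  intro hs
  obtain ⟨N, hN⟩ := (h.eventually_gt_atTop (∑' n, f n)).exists
  exact absurd (hs.sum_le_tsum (Icc 1 N) fun n _ => hf n) (not_le.2 hN)

theorem theorem1 (ψ : ℕ → ℝ) (hψ : ∀ n : ℕ, 0 ≤ ψ n)
    (hdiv : ∃ ε : ℝ, 0 < ε ∧
      Filter.Tendsto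
        (fun N : ℕ => ∑ n ∈ Finset.Icc 1 N,
          ψ n * (Nat.totient n : ℝ) / ((n : ℝ) * logOne (n : ℝ) ^ ε))
        Filter.atTop Filter.atTop) :
    MeasureTheory.volume (limsupSet ψ) = 1 ∧
      ∀ᵐ x : ℝ ∂MeasureTheory.volume, (coprimeSolutions ψ x).Infinite := by
  obtain ⟨ε, hε, hdiv⟩ := hdiv
  have hns := not_summable_of_tendsto_sum_Icc (fun n => by
    have h1 := hψ n
    have h2 := logOne_pos n
    positivity) hdiv
  -- The truncation keeps every radius at most `1 / 2`, so that balls have measure twice the radius,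
  -- and sends the radii to 0 as the zero-one law requires.
  have hcirc := ae_mem_addWellApproximable (ψ := fun n => min (ψ n) (√(n : ℝ) / 2))
    (fun n => le_min (hψ n) (by positivity)) (fun n => two_mul_min_sqrt_div_le _ n)
    (tendsto_min_sqrt_div hψ) hε (not_summable_min_sqrt hns)
  have hreal : ∀ᵐ y : ℝ, {n : ℕ | ∃ m < n, gcd m n = 1 ∧
      ‖(y : UnitAddCircle) - (((m : ℝ) / n : ℝ) : UnitAddCircle)‖ <
        min (ψ n) (√(n : ℝ) / 2) / n}.Infinite := by
    filter_upwards [ae_coe_of_ae_unitAddCircle hcirc] with y hy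
    exact (UnitAddCircle.mem_addWellApproximable_iff _ _).1 hy
  constructor
  · have hae : limsupSet ψ =ᵐ[MeasureTheory.volume] Set.Icc (0 : ℝ) 1 := by
      filter_upwards [hreal] with y hy
      refine propext ⟨fun h => h.1, fun h => ⟨h, hy.mono ?_⟩⟩
      rintro n ⟨m, hmn, hcop, hlt⟩
      exact mem_approxSet_of_norm_lt hmn hcop (min_le_left _ _) hlt
    rw [MeasureTheory.measure_congr hae, Real.volume_Icc]
    simp
  · filter_upwards [hreal] with y hy
    refine Set.Infinite.of_image Prod.snd (hy.mono ?_)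
    rintro n ⟨m, hmn, hcop, hlt⟩
    obtain ⟨a, ha⟩ := exists_mem_coprimeSolutions_of_norm_lt (ψ := ψ) hmn hcop (min_le_left _ _) hlt
    exact ⟨(a, n), ha, rfl⟩
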